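/- Let $K$ be a nonarchimedean local field and let $G$ be a finite group whose order is not divisible by the characteristic of $K$. Let $v$ be the normalized valuation of $K$, extended to $K^{\mathrm{sep}}$, and let $f:\mathrm{Gal}(K^{\mathrm{sep}}|K)\to G$ be a continuous homomorphism. **Ramification groups.** Let $I$ be the inertia group of $K^{\mathrm{sep}}|K$. For real $t\ge 0$ let $I^t=I$ if $0\le t<1$, let $I^1$ be the wild inertia group, and for $t>1$ let $I^t$ be the ramification group of $K^{\mathrm{sep}}|K$ with (usual) upper index $t-1$. Let $\overline I^t=I^1$ for $0\le t<1$ and $\overline I^t=I^t$ for $t\ge 1$. Put $e_0=\#\bigl(f(I)/f(I^1)\bigr)$, and let $\gamma_f:f(I)\to\mu_{e_0}\subset K^{\mathrm{sep}}$ be the homomorphism with kernel $f(I^1)$ given by $\gamma_f(f(\sigma))\equiv \sigma(x)/x$ modulo the maximal ideal of the valuation ring of $K^{\mathrm{sep}}$, for $\sigma\in I$ and any $x\in K^{\mathrm{sep}}$ with $v(x)=1/e_0$. **Artin conductor.** For the character $\psi$ of a complex representation of $G$, $$f_{\mathrm{Artin}}(f,\psi)=\int_0^\infty\bigl(\psi(\mathrm{id})-\langle\psi,\mathrm{triv}\rangle_{f(I^t)}\bigr)\,dt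 .$$ **Fine Artin conductor.** For a finite-dimensional representation $\tau$ of $G$ over $K$, with character $\psi$, $$f_{\mathrm{fine}}(f,\psi)=\int_0^\infty\bigl(\psi(\mathrm{id})-\langle\psi,\mathrm{triv}\rangle_{f(\overline I^t)}\bigr)\,dt+\sum_{d\mid e_0,\ d\ne e_0}\varphi\!\left(\frac{e_0}{d}\right)\langle\psi,\gamma_f^d\rangle_{f(I)},$$ where $\psi(\mathrm{id})$ stands for the integer $\dim_K\tau$, the inner products are multiplicities (non-negative integers) in the representation $K^{\mathrm{sep}}\otimes_K\tau$, and $\varphi$ is Euler's function. **Theorem.** Let $\rho$ be a finite-dimensional representation of $G$ over $\mathbb Q$ with character $\psi$, and regard $\rho$ also as a representation $\tau$ over $K$: choose a $G$-stable lattice $\Lambda$ in $\rho$ and let $\tau\cong K\otimes_{\mathbb Z}\Lambda$ (this is $K\otimes_{\mathbb Q}\rho$ if $K$ has characteristic $0$; up to isomorphism it never depends on $\Lambda$). Then the integrals defining the two conductors converge absolutely, and $$f_{\mathrm{fine}}(f,\psi)=f_{\mathrm{Artin}}(f,\psi),$$ where the left-hand side is formed with $\tau$ and the right-hand side with the complex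 character $\psi$. -/

import Mathlib

open MeasureTheory ValuativeRel
open scoped TensorProduct WithZero

namespace FineArtin

/-! ### Valuations and ramification groups -/

section LocalField

variable (K : Type*) [Field K] [ValuativeRel K] [TopologicalSpace K] [IsNonarchimedeanLocalField K]

/-- The separable closure `K^sep` of `K`. -/
abbrev Sep : Type _ := SeparableClosure K

/-- The absolute Galois group `Gal(K^sep|K)`; it carries the Krull topology. -/
abbrev AbsGal : Type _ := Sep K ≃ₐ[K] Sep K

/-- The normalized discrete valuation of `K` on nonzero elements (with value `0` at `0`). -/
noncomputable def normVal (a : K) : ℤ :=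
  -WithZero.log (IsNonarchimedeanLocalField.valueGroupWithZeroIsoInt K (valuation K a))

/-- The unique extension to `K^sep` of the normalized valuation of `K`:
`v(x) = v(N_{K(x)|K}(x)) / [K(x) : K]`, and `v(0) = ∞`.
The norm of `x` is, up to sign, the constant coefficient of the minimal polynomial. -/
noncomputable def sepVal (x : Sep K) : WithTop ℝ :=
  open Classical in
  if x = 0 then ⊤
  else (((normVal K ((minpoly K x).coeff 0) : ℝ) / ((minpoly K x).natDegree : ℝ) : ℝ) : WithTop ℝ)

variable {K}

/-- The valuation `v(π_L) = 1 / e(L|K)` of a uniformizer of a finite extension `L|K`: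
the least positive value of the valuation on `L`. -/
noncomputable def unifVal (L : IntermediateField K (Sep K)) : ℝ :=
  sInf {r : ℝ | 0 < r ∧ ∃ x ∈ L, sepVal K x = (r : WithTop ℝ)}

/-- The ramification group `G_s(L|K)` in lower numbering, for a real number `s ≥ -1`:
all `σ` with `v_L(σ x - x) ≥ s + 1` for all `x` in the valuation ring of `L`,
where `v_L = v / v(π_L)` is the normalized valuation of `L`. -/
def lowerRam (L : IntermediateField K (Sep K)) (s : ℝ) : Set (L ≃ₐ[K] L) :=
  {σ | ∀ x : L, 0 ≤ sepVal K (x : Sep K) →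
    (((s + 1) * unifVal L : ℝ) : WithTop ℝ) ≤ sepVal K ((σ x : Sep K) - (x : Sep K))}

/-- The Herbrand function `η_{L|K}(s) = ∫_0^s dx / (G_0 : G_x)`. -/
noncomputable def herbrand (L : IntermediateField K (Sep K)) (s : ℝ) : ℝ :=
  ∫ x in (0 : ℝ)..s, (Nat.card (lowerRam L x) : ℝ) / (Nat.card (lowerRam L 0) : ℝ)

/-- The ramification group in (the usual) upper numbering, for a real number `u ≥ 0`:
the group `G_s(L|K)` with `η_{L|K}(s) = u`. -/
def upperRam (L : IntermediateField K (Sep K)) (u : ℝ) : Set (L ≃ₐ[K] L) :=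
  {σ | ∃ s : ℝ, 0 ≤ s ∧ herbrand L s = u ∧ σ ∈ lowerRam L s}

variable (K)

/-- The ramification group of `K^sep|K` in the usual upper numbering (`u ≥ 0`), the inverse limit
of those of the finite Galois subextensions. For `u = 0` it is the inertia group. -/
def absUpperRam (u : ℝ) : Set (AbsGal K) :=
  {σ | ∀ (L : IntermediateField K (Sep K)) [FiniteDimensional K L] [IsGalois K L],
    AlgEquiv.restrictNormalHom L σ ∈ upperRam L u}

/-- The inertia group `I` of `K^sep|K`. -/
def inertia : Set (AbsGal K) := absUpperRam K 0

/-- The wild inertia group of `K^sep|K`, the inverse limit of the groups `G_1(L|K)`. -/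
def wildInertia : Set (AbsGal K) :=
  {σ | ∀ (L : IntermediateField K (Sep K)) [FiniteDimensional K L] [IsGalois K L],
    AlgEquiv.restrictNormalHom L σ ∈ lowerRam L 1}

/-- The ramification groups `I^t`, `t ≥ 0`, in the upper numbering shifted by one:
`I^t` is the inertia group for `0 ≤ t < 1`, `I^1` is the wild inertia group,
and for `t > 1` it is the ramification group with usual upper index `t - 1`. -/
noncomputable def ramGroup (t : ℝ) : Set (AbsGal K) :=
  open Classical in
  if t < 1 then inertia K else if t = 1 then wildInertia K else absUpperRam K (t - 1)

/-- The modified filtration: `I^1` for `t < 1`, and `I^t` for `t ≥ 1`. -/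
noncomputable def ramGroupBar (t : ℝ) : Set (AbsGal K) :=
  ramGroup K (max t 1)

variable {K}

/-- The map `γ_n : I → μ_n ⊆ K^sep`: `γ_n(σ)` is the `n`-th root of unity congruent to `σ(x)/x`
modulo the maximal ideal, where `x` is any element of valuation `1 / n`. It is only used for `n`
prime to the residue characteristic, where it is well defined. -/
noncomputable def gammaN (n : ℕ) (σ : AbsGal K) : Sep K :=
  Classical.epsilon fun ζ : Sep K => ζ ^ n = 1 ∧
    ∃ x : Sep K, sepVal K x = ((1 / (n : ℝ) : ℝ) : WithTop ℝ) ∧ 0 < sepVal K (σ x / x - ζ)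

variable {G : Type*} [Group G] [TopologicalSpace G]

/-- `e_0(f)`, the size of `f(I) / f(I^1)`. -/
noncomputable def e₀ (f : AbsGal K →ₜ* G) : ℕ :=
  Nat.card (f '' ramGroup K 0) / Nat.card (f '' ramGroup K 1)

/-- The map `γ_f : f(I) → μ_{e_0(f)} ⊆ K^sep`, `f(σ) ↦ γ_{e_0(f)}(σ)` for `σ ∈ I`
(only meaningful on `f(I)`, where it is well defined). -/
noncomputable def gammaF (f : AbsGal K →ₜ* G) (g : G) : Sep K :=
  gammaN (e₀ f) (Classical.epsilon fun σ : AbsGal K => σ ∈ inertia K ∧ f σ = g)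

end LocalField

/-! ### Inner products of characters -/

/-- The inner product `⟨ψ₁, ψ₂⟩_H` of complex-valued functions on a finite group, over a
subgroup `H`. -/
noncomputable def innerProd {G : Type*} (H : Set G) (ψ₁ ψ₂ : G → ℂ) : ℂ :=
  (Nat.card H : ℂ)⁻¹ * ∑ᶠ h ∈ H, ψ₁ h * (starRingEnd ℂ) (ψ₂ h)

section Mult

variable {F G W : Type*} [Field F] [Group G] [AddCommGroup W] [Module F W]

/-- The subspace of vectors on which each `h ∈ H` acts by the scalar `χ h`. -/
def eigenspaceOf (H : Set G) (ρ : Representation F G W) (χ : G → F) : Submodule F W where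
  carrier := {w | ∀ h ∈ H, ρ h w = χ h • w}
  add_mem' := by
    intro a b ha hb h hh
    rw [map_add, ha h hh, hb h hh, smul_add]
  zero_mem' := by
    intro h _
    rw [map_zero, smul_zero]
  smul_mem' := by
    intro c x hx h hh
    rw [map_smul, hx h hh, smul_comm]

/-- The multiplicity `⟨ρ, χ⟩_H = dim Hom_H(χ, ρ)` of a one-dimensional character `χ` of `H` in a
representation `ρ`. (The field `F` may have positive characteristic, so that this integer is not
determined by the values of the trace of `ρ` in `F`.) -/
noncomputable def mult (H : Set G) (ρ : Representation F G W) (χ : G → F) : ℕ :=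
  Module.finrank F (eigenspaceOf H ρ χ)

/-- Consistency check: in `F` the multiplicity is given by the usual inner product formula. -/
theorem mult_eq_average [FiniteDimensional F W] (H : Subgroup G) [Fintype H]
    (hH : (Fintype.card H : F) ≠ 0) (ρ : Representation F G W) (χ : G → F) (h1 : χ 1 = 1)
    (hχ : ∀ a ∈ H, ∀ b ∈ H, χ (a * b) = χ a * χ b) :
    (mult (H : Set G) ρ χ : F) =
      (Fintype.card H : F)⁻¹ * ∑ h : H, LinearMap.trace F W (ρ h) * χ (h : G)⁻¹ := by
  let p : W →ₗ[F] W := (Fintype.card H : F)⁻¹ • ∑ h : H, χ (h : G)⁻¹ • ρ h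
  have hinv : ∀ a ∈ H, χ a⁻¹ * χ a = 1 := by
    intro a ha
    rw [← hχ _ (H.inv_mem ha) _ ha, inv_mul_cancel, h1]
  have hp : LinearMap.IsProj (eigenspaceOf (H : Set G) ρ χ) p := by
    constructor
    · intro w a ha
      have ha' : a ∈ H := ha
      simp only [p, LinearMap.smul_apply, LinearMap.sum_apply, map_smul, map_sum]
      rw [smul_comm]
      congr 1
      rw [Finset.smul_sum]
      refine Fintype.sum_equiv (Equiv.mulLeft (⟨a, ha'⟩ : H)) _ _ ?_
      intro h
      have e : ρ (a * (h : G)) w = ρ a (ρ (h : G) w) := by rw [map_mul]; rfl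
      simp only [Equiv.coe_mulLeft, Subgroup.coe_mul, e, smul_smul]
      congr 1
      rw [mul_inv_rev, hχ _ (H.inv_mem h.2) _ (H.inv_mem ha'), mul_left_comm, mul_comm (χ a),
        hinv a ha', mul_one]
    · intro w hw
      have : ∀ h : H, (χ (h : G)⁻¹ • ρ (h : G)) w = w := by
        intro h
        rw [LinearMap.smul_apply, hw h h.2, smul_smul, hinv _ h.2, one_smul]
      simp only [p, LinearMap.smul_apply, LinearMap.sum_apply] at this ⊢
      rw [Finset.sum_congr rfl (fun h _ => this h), Finset.sum_const, Finset.card_univ,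
        ← Nat.cast_smul_eq_nsmul F, smul_smul, inv_mul_cancel₀ hH, one_smul]
  have ht := hp.trace
  rw [mult, ← ht]
  simp only [p, map_smul, map_sum, smul_eq_mul]
  congr 1
  exact Finset.sum_congr rfl fun h _ => mul_comm _ _

/-- Extension of scalars of a representation from `F` to an extension field `E`. -/
noncomputable def extendScalars (E : Type*) [Field E] [Algebra F E] (ρ : Representation F G W) :
    Representation E G (E ⊗[F] W) :=
  ((Module.End.baseChangeHom F E W : Module.End F W →ₐ[F] _) : Module.End F W →* _).comp ρ

end Mult

/-! ### The two conductors -/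

section Conductors

variable {K : Type*} [Field K] [ValuativeRel K] [TopologicalSpace K] [IsNonarchimedeanLocalField K]
variable {G : Type*} [Group G] [TopologicalSpace G]

/-- The integrand `ψ(id) - ⟨ψ, triv⟩_{f(I^t)}` of the Artin conductor. -/
noncomputable def artinIntegrand (f : AbsGal K →ₜ* G) (ψ : G → ℂ) (t : ℝ) : ℂ :=
  ψ 1 - innerProd (f '' ramGroup K t) ψ 1

/-- The Artin conductor of `f` with respect to the character `ψ` of a complex representation. -/
noncomputable def artinConductor (f : AbsGal K →ₜ* G) (ψ : G → ℂ) : ℂ :=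
  ∫ t in Set.Ioi (0 : ℝ), artinIntegrand f ψ t

variable {W : Type*} [AddCommGroup W] [Module K W]

/-- The integrand `ψ(id) - ⟨ψ, triv⟩_{f(Ī^t)}` of the fine Artin conductor, where `ψ` is the
character of the representation `τ` of `G` over `K`. Inner products are taken over `K^sep`. -/
noncomputable def fineIntegrand (f : AbsGal K →ₜ* G) (τ : Representation K G W) (t : ℝ) : ℝ :=
  (Module.finrank K W : ℝ) - (mult (f '' ramGroupBar K t) (extendScalars (Sep K) τ) 1 : ℝ)

/-- The fine Artin conductor of `f` with respect to a representation `τ` of `G` over `K`. -/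
noncomputable def fineConductor (f : AbsGal K →ₜ* G) (τ : Representation K G W) : ℝ :=
  (∫ t in Set.Ioi (0 : ℝ), fineIntegrand f τ t) +
    ∑ d ∈ (e₀ f).properDivisors, (Nat.totient (e₀ f / d) : ℝ) *
      (mult (f '' ramGroup K 0) (extendScalars (Sep K) τ) (gammaF f ^ d) : ℝ)

end Conductors

/-! ### Representations defined over `ℚ`, viewed over `K` -/

section Correspondence

variable {G : Type*} [Group G]

/-- `τ` is the representation over `K` corresponding to the representation `ρ` over `ℚ`: there is
an integral matrix form `M` of `ρ` (equivalently, a `G`-stable lattice with a chosen basis)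
such that `τ` is given by the image of `M` in matrices over `K`. If `K` has characteristic zero,
this means that `τ ≅ K ⊗ ρ`; if it has characteristic `p ∤ #G`, `τ` is the reduction mod `p` of a
`G`-stable lattice, with scalars extended from `𝔽_p` to `K`, and it is unique up to isomorphism. -/
def Corresponds {V : Type*} [AddCommGroup V] [Module ℚ V]
    {K : Type*} [Field K] {W : Type*} [AddCommGroup W] [Module K W]
    (ρ : Representation ℚ G V) (τ : Representation K G W) : Prop :=
  ∃ (n : ℕ) (b : Module.Basis (Fin n) ℚ V) (c : Module.Basis (Fin n) K W)
    (M : G → Matrix (Fin n) (Fin n) ℤ), ∀ g : G,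
      LinearMap.toMatrix b b (ρ g) = (M g).map (Int.cast : ℤ → ℚ) ∧
      LinearMap.toMatrix c c (τ g) = (M g).map (Int.cast : ℤ → K)

/-- Every representation of a finite group over `ℚ` has an integral matrix form. -/
theorem exists_integral_form [Finite G] {V : Type*} [AddCommGroup V] [Module ℚ V]
    [FiniteDimensional ℚ V] (ρ : Representation ℚ G V) :
    ∃ (n : ℕ) (b : Module.Basis (Fin n) ℚ V) (M : G →* Matrix (Fin n) (Fin n) ℤ), ∀ g : G,
      LinearMap.toMatrix b b (ρ g) = (M g).map (Int.cast : ℤ → ℚ) := by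
  classical
  let b₀ := Module.finBasis ℚ V
  let S : Set V := Set.range fun q : G × Fin (Module.finrank ℚ V) => ρ q.1 (b₀ q.2)
  let Λ : Submodule ℤ V := Submodule.span ℤ S
  have hstab : ∀ g : G, ∀ v ∈ Λ, ρ g v ∈ Λ := by
    intro g v hv
    induction hv using Submodule.span_induction with
    | mem x hx =>
      obtain ⟨q, rfl⟩ := hx
      refine Submodule.subset_span ⟨(g * q.1, q.2), ?_⟩
      simp only [map_mul]
      rfl
    | zero => rw [map_zero]; exact Λ.zero_mem
    | add x y _ _ hx hy => rw [map_add]; exact Λ.add_mem hx hy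
    | smul a x _ hx => rw [map_zsmul]; exact Λ.smul_mem a hx
  have : Module.Finite ℤ Λ := Module.Finite.span_of_finite ℤ (Set.finite_range _)
  have : IsAddTorsionFree V := IsAddTorsionFree.of_module_rat V
  have : Module.Free ℤ Λ := inferInstance
  let bΛ := Module.finBasis ℤ Λ
  have hli : LinearIndependent ℚ fun i => (bΛ i : V) := by
    rw [← LinearIndependent.iff_fractionRing ℤ ℚ]
    exact bΛ.linearIndependent.map' Λ.subtype (Submodule.ker_subtype Λ)
  have hrep : ∀ x : Λ, (x : V) = ∑ i, ((bΛ.repr x i : ℤ) : ℚ) • (bΛ i : V) := by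
    intro x
    have h := congrArg Λ.subtype (bΛ.sum_repr x)
    rw [map_sum] at h
    simp only [map_smul, Submodule.subtype_apply] at h
    rw [← h]
    exact Finset.sum_congr rfl fun i _ => (Int.cast_smul_eq_zsmul ℚ _ _).symm
  have hsp : ⊤ ≤ Submodule.span ℚ (Set.range fun i => (bΛ i : V)) := by
    rw [← b₀.span_eq, Submodule.span_le]
    rintro _ ⟨i, rfl⟩
    have hi : b₀ i ∈ Λ := Submodule.subset_span ⟨(1, i), by simp⟩
    have := hrep ⟨b₀ i, hi⟩
    simp only at this
    rw [SetLike.mem_coe, this]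
    exact Submodule.sum_mem _ fun j _ => Submodule.smul_mem _ _ (Submodule.subset_span ⟨j, rfl⟩)
  let b := Module.Basis.mk hli hsp
  have hb : ∀ i, b i = (bΛ i : V) := fun i => Module.Basis.mk_apply hli hsp i
  let M₀ : G → Matrix _ _ ℤ := fun g => Matrix.of fun i j =>
    bΛ.repr ⟨ρ g (bΛ j), hstab g _ (bΛ j).2⟩ i
  have key : ∀ g : G, LinearMap.toMatrix b b (ρ g) = (M₀ g).map (Int.cast : ℤ → ℚ) := by
    intro g
    ext i j
    rw [LinearMap.toMatrix_apply, hb]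
    have := hrep ⟨ρ g (bΛ j), hstab g _ (bΛ j).2⟩
    simp only [← hb] at this
    rw [← hb, this, Module.Basis.repr_sum_self]
    simp only [M₀, Matrix.map_apply, Matrix.of_apply, hb]
  have hinj : Function.Injective fun A : Matrix (Fin (Module.finrank ℤ Λ))
      (Fin (Module.finrank ℤ Λ)) ℤ => A.map (Int.cast : ℤ → ℚ) :=
    Matrix.map_injective Int.cast_injective
  refine ⟨_, b, { toFun := M₀, map_one' := hinj ?_, map_mul' := fun g h => hinj ?_ }, key⟩
  · simp only
    rw [← key, map_one, LinearMap.toMatrix_one]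
    exact ((Int.castRingHom ℚ).mapMatrix.map_one).symm
  · simp only
    rw [← key, map_mul, LinearMap.toMatrix_mul, key, key]
    exact ((Int.castRingHom ℚ).mapMatrix.map_mul _ _).symm

/-- Over any field, a corresponding representation exists. -/
theorem exists_corresponds [Finite G] {V : Type*} [AddCommGroup V] [Module ℚ V]
    [FiniteDimensional ℚ V] (K : Type*) [Field K] (ρ : Representation ℚ G V) :
    ∃ (n : ℕ) (τ : Representation K G (Fin n → K)), Corresponds ρ τ := by
  obtain ⟨n, b, M, hM⟩ := exists_integral_form ρ
  refine ⟨n, ((Matrix.toLinAlgEquiv' : Matrix (Fin n) (Fin n) K ≃ₐ[K] _) :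
    Matrix (Fin n) (Fin n) K →* _).comp
      (((Int.castRingHom K).mapMatrix (m := Fin n)).toMonoidHom.comp M),
    n, b, Pi.basisFun K (Fin n), M, fun g => ⟨hM g, ?_⟩⟩
  rw [LinearMap.toMatrix_eq_toMatrix']
  exact LinearMap.toMatrix'_toLin' _

/-- In characteristic zero, `K ⊗ ρ` corresponds to `ρ`. -/
theorem corresponds_extendScalars [Finite G] {V : Type*} [AddCommGroup V] [Module ℚ V]
    [FiniteDimensional ℚ V] (K : Type*) [Field K] [CharZero K] (ρ : Representation ℚ G V) :
    Corresponds ρ (extendScalars K ρ) := by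
  obtain ⟨n, b, M, hM⟩ := exists_integral_form ρ
  refine ⟨n, b, Algebra.TensorProduct.basis K b, M, fun g => ⟨hM g, ?_⟩⟩
  have : extendScalars K ρ g = (ρ g).baseChange K := rfl
  rw [this, LinearMap.toMatrix_baseChange, hM]
  ext i j
  simp

end Correspondence

end FineArtin

/-!
The two integrands agree for `t > 1`, where both filtrations are the usual upper numbering
filtration, so the theorem is a statement about the interval `(0, 1)`. Let `D = f(I)` and
`P = f(I^1)`. On `(0, 1)` the Artin integrand is `dim ψ - dim ψ^D` and the integrand of the fine
conductor is `dim ψ - dim ψ^P`. Hence one has to see that `dim ψ^P - dim ψ^D` is the sum over the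
proper divisors `d` of `e₀` in the fine conductor (`mult_wildImage_eq`). Over the complex numbers
the invariants of `P` decompose under the characters of the cyclic group `D / P` of order `e₀`;
since `ρ` is rational, the multiplicity of such a character depends only on its order `e₀ / d`,
and there are `φ(e₀ / d)` characters of this order.

Representation theory. The multiplicities over `K^sep` are compared with those over `ℂ` for a
character whose values are powers of a primitive `n`-th root of unity `ζ` in `K^sep`, respectively
`ω` in `ℂ` (`mult_eq_of_isPrimitiveRoot`). The averaging operator onto the eigenspace, multiplied by
the group order, is the value at the root of unity of one matrix over `ℤ[X]`, and the multiplicity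
is the multiplicity of the root `#H` of its characteristic polynomial. The complex characteristic
polynomial is known, and a relation over `ℤ` satisfied by `ω` is divisible by the cyclotomic
polynomial, so that it holds for `ζ` as well. As `ω` is an arbitrary primitive root of unity, this
contains the rationality statement.

Arithmetic. It has to be shown that `γ_f` is a character of `D` with kernel `P` and with image the
group of `e₀`-th roots of unity, where `e₀` is prime to the residue characteristic
(`exists_gammaF_eq_pow`). The valuation of `K^sep` is studied through the absolute value
`sepAbs K = exp (-v)`, which is the spectral norm; the condition `sepAbs K (n : Sep K) = 1` says
that `n` is prime to the residue characteristic.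
* The inertia group is the fixing group of the roots of unity of order prime to the residue
  characteristic (`inertiaGroup_eq_fixingSubgroup`), because these represent all nonzero residue
  classes. Adjoining them leaves the value group unchanged (`exists_sepAbs_eq_exp_of_fixed`), so the
  tame characters `I → μ_m` given by `m`-th roots of a uniformizer are surjective
  (`exists_tameChar_isPrimitiveRoot`).
* The wild inertia group is the common kernel of the tame characters (`mem_wildGroup_of_tameChar`).
  By compactness of `I`, the open subgroup `I ∩ f⁻¹(P)` contains the kernel of a single one of them
  (`exists_tameChar_ker_subset`), and so it is itself the kernel of the tame character of order
  equal to its index `e₀`.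

Integrability follows since the integrand is constant on `(0, 1)`, monotone on `(1, ∞)`, and zero
for large `t`, as the ramification groups of a finite extension are eventually trivial.
-/

namespace FineArtin

open scoped NNReal

/-! ### The absolute value of the separable closure -/

section Norm
variable (K : Type*) [Field K] [ValuativeRel K] [TopologicalSpace K] [IsNonarchimedeanLocalField K]

/-- The number `e = exp 1`, the base of the absolute value `exp (-v)`. -/
noncomputable def expOne : ℝ≥0 := ⟨Real.exp 1, (Real.exp_pos 1).le⟩

theorem one_lt_expOne : 1 < expOne := by
  have : (1 : ℝ) < Real.exp 1 := by simp
  exact this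

/-- The embedding of the value group of `K` in `ℝ≥0` that sends a uniformizer to `exp (-1)`. -/
noncomputable def baseAbs : ValueGroupWithZero K →*₀ ℝ≥0 :=
  (WithZeroMulInt.toNNReal one_lt_expOne.ne_zero).comp
    (MonoidWithZeroHom.ofClass (IsNonarchimedeanLocalField.valueGroupWithZeroIsoInt K))

theorem baseAbs_strictMono : StrictMono (baseAbs K) :=
  (WithZeroMulInt.toNNReal_strictMono one_lt_expOne).comp
    (IsNonarchimedeanLocalField.valueGroupWithZeroIsoInt K).strictMono

theorem baseAbs_valuation {a : K} (ha : a ≠ 0) :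
    (baseAbs K (valuation K a) : ℝ) = Real.exp (-(normVal K a : ℝ)) := by
  have h : IsNonarchimedeanLocalField.valueGroupWithZeroIsoInt K (valuation K a) ≠ 0 := by
    simpa using ha
  have : baseAbs K (valuation K a) = expOne ^ (WithZero.unzero h).toAdd :=
    WithZeroMulInt.toNNReal_neg_apply one_lt_expOne.ne_zero h
  rw [this, normVal]
  generalize IsNonarchimedeanLocalField.valueGroupWithZeroIsoInt K (valuation K a) = y at h
  lift y to Multiplicative ℤ using h
  rw [WithZero.unzero_coe]
  have h2 : WithZero.log (y : ℤᵐ⁰) = y.toAdd := rfl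
  rw [h2]
  push_cast
  rw [neg_neg, ← Real.exp_one_rpow, Real.rpow_intCast]
  rfl

/-- The field `K` with the absolute value `exp (-v)`. -/
@[reducible]
noncomputable def normedBase : NontriviallyNormedField K :=
  letI := IsTopologicalAddGroup.rightUniformSpace K
  haveI := isUniformAddGroup_of_addCommGroup (G := K)
  letI : (Valued.v (R := K) (Γ₀ := ValueGroupWithZero K)).RankOne :=
    { hom' := (baseAbs K).comp MonoidWithZeroHom.ValueGroup₀.embedding
      strictMono' := (baseAbs_strictMono K).comp
        MonoidWithZeroHom.ValueGroup₀.embedding_strictMono }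
  Valued.toNontriviallyNormedField K (ValueGroupWithZero K)

theorem normedBase_norm (a : K) :
    (normedBase K).norm a = (baseAbs K (valuation K a) : ℝ) := by
  let := IsTopologicalAddGroup.rightUniformSpace K
  have := isUniformAddGroup_of_addCommGroup (G := K)
  change ((baseAbs K (MonoidWithZeroHom.ValueGroup₀.embedding
    ((Valued.v (R := K) (Γ₀ := ValueGroupWithZero K)).restrict a)) : ℝ≥0) : ℝ) = _
  rw [Valuation.embedding_restrict]
  rfl

theorem normedBase_complete : letI := normedBase K; CompleteSpace K := by
  let := IsTopologicalAddGroup.rightUniformSpace K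
  have := isUniformAddGroup_of_addCommGroup (G := K)
  exact inferInstanceAs (CompleteSpace K)

theorem normedBase_ultrametric : letI := normedBase K; IsUltrametricDist K := by
  let := IsTopologicalAddGroup.rightUniformSpace K
  have := isUniformAddGroup_of_addCommGroup (G := K)
  let : (Valued.v (R := K) (Γ₀ := ValueGroupWithZero K)).RankOne :=
    { hom' := (baseAbs K).comp MonoidWithZeroHom.ValueGroup₀.embedding
      strictMono' := (baseAbs_strictMono K).comp
        MonoidWithZeroHom.ValueGroup₀.embedding_strictMono }
  open scoped Valued in
  exact inferInstanceAs (IsUltrametricDist K)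

/-- The absolute value `exp (-v)` on `K^sep`, as the spectral norm over `K`. -/
noncomputable def sepAbs : Valuation (Sep K) ℝ≥0 :=
  letI := normedBase K
  haveI := normedBase_complete K
  haveI := normedBase_ultrametric K
  { toFun := fun x => ⟨spectralNorm K (Sep K) x, spectralNorm_nonneg x⟩
    map_zero' := by
      ext; exact spectralNorm_zero
    map_one' := by
      ext; exact spectralNorm_one
    map_mul' := fun x y => by
      ext; exact map_mul (spectralMulAlgNorm K (Sep K)) x y
    map_add_le_max' := fun x y => by
      exact isNonarchimedean_spectralNorm (K := K) (L := Sep K) x y }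

variable {K}

theorem sepAbs_aut (σ : AbsGal K) (x : Sep K) : sepAbs K (σ x) = sepAbs K x := by
  let := normedBase K
  have := normedBase_complete K
  have := normedBase_ultrametric K
  ext
  exact (spectralNorm_eq_of_equiv σ x).symm

theorem sepAbs_algebraMap {a : K} (ha : a ≠ 0) :
    (sepAbs K (algebraMap K (Sep K) a) : ℝ) = Real.exp (-(normVal K a : ℝ)) := by
  let := normedBase K
  have := normedBase_complete K
  have := normedBase_ultrametric K
  rw [← baseAbs_valuation K ha, ← normedBase_norm]
  exact spectralNorm_extends a

theorem sepAbs_eq_exp {x : Sep K} (hx : x ≠ 0) : (sepAbs K x : ℝ) =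
    Real.exp (-((normVal K ((minpoly K x).coeff 0) : ℝ) / ((minpoly K x).natDegree : ℝ))) := by
  let := normedBase K
  have := normedBase_complete K
  have := normedBase_ultrametric K
  have h : (minpoly K x).coeff 0 ≠ 0 :=
    minpoly.coeff_zero_ne_zero (Algebra.IsIntegral.isIntegral x) hx
  refine (spectralNorm.spectralNorm_eq_norm_coeff_zero_rpow K (Sep K) x).trans ?_
  have : ‖(minpoly K x).coeff 0‖ = Real.exp (-(normVal K ((minpoly K x).coeff 0) : ℝ)) :=
    (normedBase_norm K _).trans (baseAbs_valuation K h)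
  rw [this, ← Real.exp_mul]
  congr 1
  ring

theorem sepVal_eq_log {x : Sep K} (hx : x ≠ 0) :
    sepVal K x = ((-Real.log (sepAbs K x) : ℝ) : WithTop ℝ) := by
  rw [sepVal, if_neg hx, sepAbs_eq_exp hx, Real.log_exp, neg_neg]

theorem sepAbs_pos {x : Sep K} (hx : x ≠ 0) : 0 < (sepAbs K x : ℝ) := by
  have : sepAbs K x ≠ 0 := by simpa using hx
  exact_mod_cast pos_iff_ne_zero.mpr this

theorem le_sepVal_iff {r : ℝ} {x : Sep K} :
    (r : WithTop ℝ) ≤ sepVal K x ↔ (sepAbs K x : ℝ) ≤ Real.exp (-r) := by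
  by_cases hx : x = 0
  · subst hx
    simp [sepVal, Real.exp_nonneg]
  · rw [sepVal_eq_log hx, WithTop.coe_le_coe, ← Real.log_le_iff_le_exp (sepAbs_pos hx)]
    constructor <;> intro h <;> linarith

theorem lt_sepVal_iff {r : ℝ} {x : Sep K} :
    (r : WithTop ℝ) < sepVal K x ↔ (sepAbs K x : ℝ) < Real.exp (-r) := by
  by_cases hx : x = 0
  · subst hx
    simp [sepVal, Real.exp_pos]
  · rw [sepVal_eq_log hx, WithTop.coe_lt_coe, ← Real.log_lt_iff_lt_exp (sepAbs_pos hx)]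
    constructor <;> intro h <;> linarith

theorem sepVal_eq_iff {r : ℝ} {x : Sep K} :
    sepVal K x = (r : WithTop ℝ) ↔ (sepAbs K x : ℝ) = Real.exp (-r) := by
  rw [le_antisymm_iff, le_antisymm_iff (a := (sepAbs K x : ℝ)), ← le_sepVal_iff, ← not_lt,
    lt_sepVal_iff, not_lt, and_comm]

theorem zero_le_sepVal_iff {x : Sep K} : 0 ≤ sepVal K x ↔ sepAbs K x ≤ 1 := by
  have := le_sepVal_iff (K := K) (r := 0) (x := x)
  rw [neg_zero, Real.exp_zero] at this
  exact_mod_cast this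

theorem zero_lt_sepVal_iff {x : Sep K} : 0 < sepVal K x ↔ sepAbs K x < 1 := by
  have := lt_sepVal_iff (K := K) (r := 0) (x := x)
  rw [neg_zero, Real.exp_zero] at this
  exact_mod_cast this

theorem sepAbs_algebraMap_eq_baseAbs (a : K) :
    sepAbs K (algebraMap K (Sep K) a) = baseAbs K (valuation K a) := by
  let := normedBase K
  have := normedBase_complete K
  have := normedBase_ultrametric K
  ext
  rw [← normedBase_norm]
  exact spectralNorm_extends a

/-- The minimal polynomial of an element of absolute value at most `1` has integral coefficients,
by the definition of the spectral norm. -/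
theorem coeff_minpoly_mem_integer {x : Sep K} (hx : sepAbs K x ≤ 1) (n : ℕ) :
    (minpoly K x).coeff n ∈ 𝒪[K] := by
  let := normedBase K
  have hx' : spectralValue (minpoly K x) ≤ 1 := hx
  have h := (spectralValue_le_one_iff (minpoly.monic (Algebra.IsIntegral.isIntegral x))).mp hx' n
  rw [Valuation.mem_integer_iff, ← (baseAbs_strictMono K).le_iff_le, map_one]
  have h2 := normedBase_norm K ((minpoly K x).coeff n)
  exact_mod_cast h2.symm.le.trans h

variable (K) in
theorem exists_uniformizer : ∃ ϖ : K, ϖ ≠ 0 ∧ normVal K ϖ = 1 := by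
  obtain ⟨a, ha⟩ := ValuativeRel.valuation_surjective
    ((IsNonarchimedeanLocalField.valueGroupWithZeroIsoInt K).symm (WithZero.exp (-1 : ℤ)))
  refine ⟨a, ?_, ?_⟩
  · rintro rfl
    have := congrArg (IsNonarchimedeanLocalField.valueGroupWithZeroIsoInt K) ha
    simp only [map_zero, OrderMonoidIso.apply_symm_apply] at this
    exact WithZero.exp_ne_zero this.symm
  · rw [normVal, ha, OrderMonoidIso.apply_symm_apply, WithZero.log_exp, neg_neg]

end Norm

/-! ### The residue field of the separable closure -/

theorem exists_isPrimitiveRoot {F : Type*} [Field F] [IsSepClosed F] {n : ℕ} (hn : (n : F) ≠ 0) :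
    ∃ ζ : F, IsPrimitiveRoot ζ n := by
  have h0 : n ≠ 0 := by rintro rfl; simp at hn
  have := IsSepClosed.isCyclotomicExtension {n} F (by
    rintro a rfl _; exact ⟨hn⟩)
  exact this.1 rfl h0

section Residue
open Polynomial
variable (K : Type*) [Field K] [ValuativeRel K] [TopologicalSpace K] [IsNonarchimedeanLocalField K]

/-- The valuation ring of `K^sep`. -/
noncomputable abbrev SepInt : ValuationSubring (Sep K) := (sepAbs K).valuationSubring

/-- The residue field of `K^sep`. -/
abbrev SepRes : Type _ := IsLocalRing.ResidueField (SepInt K)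

/-- The inclusion of the valuation ring of `K` in that of `K^sep`. -/
noncomputable def intMap : 𝒪[K] →+* SepInt K :=
  ((algebraMap K (Sep K)).comp (𝒪[K]).subtype).codRestrict (SepInt K).toSubring fun a => by
    change sepAbs K (algebraMap K (Sep K) a) ≤ 1
    rw [sepAbs_algebraMap_eq_baseAbs, ← map_one (baseAbs K), (baseAbs_strictMono K).le_iff_le]
    exact a.2

instance : IsLocalHom (intMap K) := by
  refine ⟨fun a ha => ?_⟩
  have h1 : sepAbs K (algebraMap K (Sep K) a) = 1 := by
    refine le_antisymm (intMap K a).2 (not_lt.mp fun h => ?_)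
    have := (Valuation.mem_maximalIdeal_iff (v := sepAbs K) (a := intMap K a)).mpr h
    exact (IsLocalRing.mem_maximalIdeal _).mp this ha
  rw [sepAbs_algebraMap_eq_baseAbs, ← map_one (baseAbs K),
    (baseAbs_strictMono K).injective.eq_iff] at h1
  exact (Valuation.integer.integers (valuation K)).isUnit_iff_valuation_eq_one.mpr h1

/-- The embedding of the residue field of `K` in that of `K^sep`. -/
noncomputable def resMap : 𝓀[K] →+* SepRes K := IsLocalRing.ResidueField.map (intMap K)

variable {K}

theorem residue_eq_zero_iff {x : SepInt K} :
    IsLocalRing.residue (SepInt K) x = 0 ↔ sepAbs K (x : Sep K) < 1 := by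
  rw [IsLocalRing.residue_eq_zero_iff, Valuation.mem_maximalIdeal_iff]

theorem residue_eq_iff {x y : SepInt K} :
    IsLocalRing.residue (SepInt K) x = IsLocalRing.residue (SepInt K) y ↔
      sepAbs K ((x : Sep K) - y) < 1 := by
  rw [← sub_eq_zero, ← map_sub, residue_eq_zero_iff]
  rfl

theorem sepAbs_natCast_le_one (n : ℕ) : sepAbs K (n : Sep K) ≤ 1 := (n : SepInt K).2

theorem natCast_residue_ne_zero_iff (n : ℕ) : ((n : SepRes K) ≠ 0) ↔ sepAbs K (n : Sep K) = 1 := by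
  have : (n : SepRes K) = IsLocalRing.residue (SepInt K) (n : SepInt K) := (map_natCast _ n).symm
  rw [this, Ne, residue_eq_zero_iff, not_lt]
  exact ⟨fun h => le_antisymm (sepAbs_natCast_le_one n) h, fun h => h.ge⟩

theorem natCast_ne_zero_of_sepAbs {n : ℕ} (hn : sepAbs K (n : Sep K) = 1) : (n : Sep K) ≠ 0 := by
  intro h; rw [h, map_zero] at hn; exact zero_ne_one hn

theorem sepAbs_eq_one_of_pow {ζ : Sep K} {n : ℕ} (hn : n ≠ 0) (h : ζ ^ n = 1) :
    sepAbs K ζ = 1 := by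
  have : sepAbs K ζ ^ n = 1 := by rw [← map_pow, h, map_one]
  exact (pow_eq_one_iff_of_nonneg zero_le hn).mp this

theorem ne_zero_of_sepAbs {n : ℕ} (hn : sepAbs K (n : Sep K) = 1) : n ≠ 0 := by
  rintro rfl; simp at hn

/-- Reduction is injective on roots of unity of order prime to the residue characteristic. -/
theorem eq_one_of_pow_of_sepAbs_sub_lt {ζ : Sep K} {n : ℕ} (hn : sepAbs K (n : Sep K) = 1)
    (h : ζ ^ n = 1) (h1 : sepAbs K (ζ - 1) < 1) : ζ = 1 := by
  have hn0 := ne_zero_of_sepAbs hn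
  let z : SepInt K := ⟨ζ, (sepAbs_eq_one_of_pow hn0 h).le⟩
  have hz : IsLocalRing.residue (SepInt K) z = 1 := by
    rw [← map_one (IsLocalRing.residue (SepInt K)), residue_eq_iff]; exact h1
  have hs : IsLocalRing.residue (SepInt K) (∑ i ∈ Finset.range n, z ^ i) ≠ 0 := by
    rw [map_sum]
    simp only [map_pow, hz, one_pow, Finset.sum_const, Finset.card_range, nsmul_eq_mul, mul_one]
    exact (natCast_residue_ne_zero_iff n).mpr hn
  have hs' : (∑ i ∈ Finset.range n, z ^ i) ≠ 0 := fun h => hs (by rw [h, map_zero])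
  have hg := mul_geom_sum z n
  have hzn : z ^ n = 1 := Subtype.ext h
  rw [hzn, sub_self] at hg
  have := (mul_eq_zero.mp hg).resolve_right hs'
  exact congrArg Subtype.val (sub_eq_zero.mp this)

theorem eq_of_pow_of_sepAbs_sub_lt {ζ ξ : Sep K} {n : ℕ} (hn : sepAbs K (n : Sep K) = 1)
    (h : ζ ^ n = 1) (h' : ξ ^ n = 1) (h1 : sepAbs K (ζ - ξ) < 1) : ζ = ξ := by
  have hξ := sepAbs_eq_one_of_pow (ne_zero_of_sepAbs hn) h'
  have hξ0 : ξ ≠ 0 := by rintro rfl; simp at hξ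
  have : ζ / ξ = 1 := by
    refine eq_one_of_pow_of_sepAbs_sub_lt hn (by rw [div_pow, h, h', div_one]) ?_
    rw [div_sub_one hξ0, map_div₀, hξ, div_one]; exact h1
  exact (div_eq_one_iff_eq hξ0).mp this

theorem residue_isIntegralElem (x : SepInt K) :
    (resMap K).IsIntegralElem (IsLocalRing.residue (SepInt K) x) := by
  let P := (minpoly K (x : Sep K)).toSubring 𝒪[K] (by
    intro a ha
    obtain ⟨n, -, rfl⟩ := mem_coeffs_iff.mp ha
    exact coeff_minpoly_mem_integer x.2 n)
  have hP : P.Monic := (monic_toSubring _ _ _).mpr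
    (minpoly.monic (Algebra.IsIntegral.isIntegral _))
  have hx : eval₂ (intMap K) x P = 0 := by
    apply Subtype.val_injective
    change (SepInt K).subtype _ = 0
    rw [hom_eval₂]
    have : ((SepInt K).subtype.comp (intMap K)) =
      (algebraMap K (Sep K)).comp (𝒪[K]).subtype := rfl
    rw [this, ← eval₂_map]
    have h2 : P.map (𝒪[K]).subtype = minpoly K (x : Sep K) := map_toSubring _ _ _
    rw [h2]
    exact minpoly.aeval K (x : Sep K)
  refine ⟨P.map (IsLocalRing.residue 𝒪[K]), hP.map _, ?_⟩
  rw [eval₂_map, resMap, IsLocalRing.ResidueField.map_comp_residue, ← hom_eval₂, hx, map_zero]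

/-- Every unit of `K^sep` is congruent to a root of unity of order prime to the residue
characteristic. -/
theorem exists_root_of_unity_sub_lt {x : Sep K} (hx : sepAbs K x = 1) :
    ∃ (n : ℕ) (ζ : Sep K), sepAbs K (n : Sep K) = 1 ∧ ζ ^ n = 1 ∧ sepAbs K (x - ζ) < 1 := by
  let z : SepInt K := ⟨x, hx.le⟩
  let r := IsLocalRing.residue (SepInt K) z
  have hr : r ≠ 0 := by
    rw [Ne, residue_eq_zero_iff, not_lt]; exact hx.ge
  let := (resMap K).toAlgebra
  have hint : IsIntegral 𝓀[K] r := residue_isIntegralElem z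
  have hfin : Module.Finite 𝓀[K] (Algebra.adjoin 𝓀[K] {r}) :=
    Module.Finite.iff_fg.mpr hint.fg_adjoin_singleton
  have : Finite (Algebra.adjoin 𝓀[K] {r}) := Module.finite_of_finite 𝓀[K]
  -- `r` lies in a finite ring, so it is a root of unity; its order is prime to the residue
  -- characteristic, as a primitive root of unity of this order exists in the residue field
  obtain ⟨i, j, hij, hpow⟩ : ∃ i j : ℕ, i < j ∧ r ^ i = r ^ j := by
    obtain ⟨i, j, hne, h⟩ := Finite.exists_ne_map_eq_of_infinite
      (fun i : ℕ => (⟨r, Algebra.self_mem_adjoin_singleton _ r⟩ : Algebra.adjoin 𝓀[K] {r}) ^ i)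
    have h' : r ^ i = r ^ j := congrArg Subtype.val h
    rcases lt_or_gt_of_ne hne with h1 | h1
    · exact ⟨i, j, h1, h'⟩
    · exact ⟨j, i, h1, h'.symm⟩
  have h1 : r ^ (j - i) = 1 := by
    have : r ^ i * r ^ (j - i) = r ^ i * 1 := by
      rw [← pow_add, Nat.add_sub_cancel' hij.le, mul_one, hpow]
    exact mul_left_cancel₀ (pow_ne_zero _ hr) this
  have hpos : 0 < orderOf r := orderOf_pos_iff.mpr
    (isOfFinOrder_iff_pow_eq_one.mpr ⟨_, Nat.sub_pos_of_lt hij, h1⟩)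
  have : NeZero (orderOf r) := ⟨hpos.ne'⟩
  have hn := (natCast_residue_ne_zero_iff (K := K) (orderOf r)).mp
    (IsPrimitiveRoot.orderOf r).neZero'.out
  have hrn := pow_orderOf_eq_one r
  generalize orderOf r = n at hpos hn hrn this
  obtain ⟨ξ, hξ⟩ := exists_isPrimitiveRoot (natCast_ne_zero_of_sepAbs hn)
  have hprod : x ^ n - 1 = ∏ ζ ∈ nthRootsFinset n (1 : Sep K), (x - ζ) := by
    have h := congrArg (eval x) (X_pow_sub_one_eq_prod hpos hξ)
    simpa [eval_prod] using h
  have hlt : sepAbs K (x ^ n - 1) < 1 := by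
    have : IsLocalRing.residue (SepInt K) (z ^ n) = IsLocalRing.residue (SepInt K) 1 := by
      rw [map_pow, map_one]; exact hrn
    have h := residue_eq_iff.mp this
    rwa [SubmonoidClass.coe_pow, OneMemClass.coe_one] at h
  rw [hprod, map_prod] at hlt
  -- the product of the `x - ζ` is small, hence so is one of the factors
  by_contra! hcon
  refine absurd hlt (not_lt.mpr ?_)
  calc (1 : ℝ≥0) = ∏ _ζ ∈ nthRootsFinset n (1 : Sep K), 1 := Finset.prod_const_one.symm
    _ ≤ _ := Finset.prod_le_prod (fun _ _ => zero_le_one) fun ζ hζ =>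
      hcon n ζ hn ((mem_nthRootsFinset hpos _).mp hζ)

theorem exists_residue_char : ∃ p : ℕ, p.Prime ∧ CharP (SepRes K) p := by
  obtain ⟨p, hp⟩ := CharP.exists 𝓀[K]
  have hp0 : p ≠ 0 := by
    rintro rfl
    have := CharP.charP_to_charZero 𝓀[K]
    exact not_finite_iff_infinite.mpr (inferInstance : Infinite 𝓀[K]) inferInstance
  exact ⟨p, (CharP.char_is_prime_or_zero 𝓀[K] p).resolve_right hp0,
    charP_of_injective_ringHom (resMap K).injective p⟩

end Residue

/-! ### Roots of unity and unramified extensions -/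

section Unramified
open Polynomial IntermediateField
variable {K : Type*} [Field K] [ValuativeRel K] [TopologicalSpace K] [IsNonarchimedeanLocalField K]

theorem subtype_comp_intMap :
    (SepInt K).subtype.comp (intMap K) = (algebraMap K (Sep K)).comp (𝒪[K]).subtype := rfl

/-- The reduction of the value at an integral point of a polynomial over the valuation ring. -/
theorem eval₂_residue (P : 𝒪[K][X]) (z : SepInt K) :
    (P.map (IsLocalRing.residue 𝒪[K])).eval₂ (resMap K) (IsLocalRing.residue (SepInt K) z) =
      IsLocalRing.residue (SepInt K) (P.eval₂ (intMap K) z) := by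
  rw [eval₂_map, resMap, IsLocalRing.ResidueField.map_comp_residue, ← hom_eval₂]

theorem coe_eval₂_intMap (P : 𝒪[K][X]) (z : SepInt K) :
    ((P.eval₂ (intMap K) z : SepInt K) : Sep K) = aeval (z : Sep K) (P.map (𝒪[K]).subtype) := by
  change (SepInt K).subtype _ = _
  rw [hom_eval₂, subtype_comp_intMap, aeval_def, eval₂_map]
  rfl

/-- The degree of a root of unity of order prime to the residue characteristic is at most the
degree of its reduction: the conjugates have distinct reductions, which are conjugate. -/
theorem natDegree_minpoly_le_residue {z : SepInt K} {n : ℕ} (hn : sepAbs K (n : Sep K) = 1)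
    (hz : (z : Sep K) ^ n = 1) :
    letI := (resMap K).toAlgebra
    (minpoly K (z : Sep K)).natDegree ≤
      (minpoly 𝓀[K] (IsLocalRing.residue (SepInt K) z)).natDegree := by
  classical
  let := (resMap K).toAlgebra
  have hint : IsIntegral 𝓀[K] (IsLocalRing.residue (SepInt K) z) := residue_isIntegralElem z
  set q := minpoly 𝓀[K] (IsLocalRing.residue (SepInt K) z) with hq
  have hq0 : q ≠ 0 := minpoly.ne_zero hint
  obtain ⟨P, hP⟩ := map_surjective (IsLocalRing.residue 𝒪[K]) IsLocalRing.residue_surjective q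
  have hsep : (minpoly K (z : Sep K)).Separable := Algebra.IsSeparable.isSeparable K (z : Sep K)
  have hspl := Normal.splits (F := K) (K := Sep K) inferInstance (z : Sep K)
  have hcard := card_rootSet_eq_natDegree hsep hspl
  have hroot : ∀ y ∈ (minpoly K (z : Sep K)).rootSet (Sep K),
      y ^ n = 1 ∧ ∃ σ : AbsGal K, σ z = y := by
    intro y hy
    obtain ⟨σ, hσ⟩ := minpoly.exists_algEquiv_of_root' (K := K)
      (Algebra.IsAlgebraic.isAlgebraic (z : Sep K)) ((mem_rootSet.mp hy).2)
    exact ⟨by rw [← hσ, ← map_pow, hz, map_one], σ, hσ⟩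
  let r : (minpoly K (z : Sep K)).rootSet (Sep K) → q.rootSet (SepRes K) := fun y =>
    ⟨IsLocalRing.residue (SepInt K)
      ⟨y.1, (sepAbs_eq_one_of_pow (ne_zero_of_sepAbs hn) (hroot y.1 y.2).1).le⟩, by
      obtain ⟨h1, σ, hσ⟩ := hroot y.1 y.2
      rw [mem_rootSet]
      refine ⟨hq0, ?_⟩
      rw [aeval_def, ← hP]
      refine (eval₂_residue P _).trans ?_
      rw [residue_eq_zero_iff, coe_eval₂_intMap]
      change sepAbs K (aeval y.1 _) < 1
      rw [← hσ, ← AlgEquiv.coe_toAlgHom, aeval_algHom_apply]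
      refine (sepAbs_aut σ _).trans_lt ?_
      rw [← coe_eval₂_intMap, ← residue_eq_zero_iff, ← eval₂_residue, hP]
      exact minpoly.aeval _ _⟩
  have hinj : Function.Injective r := by
    intro y y' h
    have h1 := residue_eq_iff.mp (congrArg Subtype.val h)
    exact Subtype.ext (eq_of_pow_of_sepAbs_sub_lt hn (hroot y.1 y.2).1 (hroot y'.1 y'.2).1 h1)
  rw [← hcard]
  refine (Fintype.card_le_of_injective r hinj).trans ?_
  rw [← Nat.card_eq_fintype_card, Nat.card_coe_set_eq]
  exact ncard_rootSet_le q (SepRes K)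

/-- Adjoining a root of unity of order prime to the residue characteristic does not enlarge the
value group. -/
theorem exists_sepAbs_eq_exp_of_mem_adjoin {ζ : Sep K} {n : ℕ} (hn : sepAbs K (n : Sep K) = 1)
    (hζ : ζ ^ n = 1) {y : Sep K} (hy : y ∈ K⟮ζ⟯) (hy0 : y ≠ 0) :
    ∃ k : ℤ, (sepAbs K y : ℝ) = Real.exp k := by
  let := (resMap K).toAlgebra
  let z : SepInt K := ⟨ζ, (sepAbs_eq_one_of_pow (ne_zero_of_sepAbs hn) hζ).le⟩
  have hintζ : IsIntegral K ζ := Algebra.IsIntegral.isIntegral ζ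
  obtain ⟨q, hqd, hq⟩ : ∃ q : K[X], q.degree < (minpoly K ζ).degree ∧ aeval ζ q = y := by
    rw [← IntermediateField.mem_toSubalgebra,
      adjoin_simple_toSubalgebra_of_isAlgebraic hintζ.isAlgebraic,
      Algebra.adjoin_singleton_eq_range_aeval] at hy
    obtain ⟨q, rfl⟩ := hy
    refine ⟨q %ₘ minpoly K ζ, degree_modByMonic_lt _ (minpoly.monic hintζ), ?_⟩
    exact aeval_modByMonic_eq_self_of_root (minpoly.aeval K ζ)
  have hq0 : q ≠ 0 := by rintro rfl; exact hy0 (by rw [← hq, map_zero])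
  -- divide `q` by a coefficient of maximal absolute value: the reduction of the quotient `q'` is
  -- nonzero, of degree less than that of the reduction of `ζ`, so that `q'(ζ)` is a unit
  obtain ⟨i, hi, hmax⟩ := q.support.exists_max_image (fun i => valuation K (q.coeff i))
    (support_nonempty.mpr hq0)
  have ha : q.coeff i ≠ 0 := mem_support_iff.mp hi
  set a := q.coeff i with ha_def
  let q' : K[X] := C a⁻¹ * q
  have hq' : ∀ j, q'.coeff j ∈ 𝒪[K] := by
    intro j
    rw [Valuation.mem_integer_iff, coeff_C_mul, map_mul, map_inv₀]
    by_cases hj : q.coeff j = 0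
    · simp [hj]
    · have := hmax j (mem_support_iff.mpr hj)
      rw [mul_comm]
      exact mul_inv_le_one_of_le₀ this zero_le
  let Q := q'.toSubring 𝒪[K] (by
    intro b hb
    obtain ⟨j, -, rfl⟩ := mem_coeffs_iff.mp hb
    exact hq' j)
  have hQ : Q.map (𝒪[K]).subtype = q' := map_toSubring _ _ _
  have hQi : Q.coeff i = 1 := by
    apply Subtype.val_injective
    have h := coeff_toSubring' q' 𝒪[K] (by
      intro b hb
      obtain ⟨j, -, rfl⟩ := mem_coeffs_iff.mp hb
      exact hq' j) (n := i)
    exact h.trans (by rw [coeff_C_mul, inv_mul_cancel₀ ha]; rfl)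
  have hQ0 : Q.map (IsLocalRing.residue 𝒪[K]) ≠ 0 := by
    intro h
    have := congrArg (fun p => p.coeff i) h
    simp [hQi] at this
  have hdeg : (Q.map (IsLocalRing.residue 𝒪[K])).degree <
      (minpoly 𝓀[K] (IsLocalRing.residue (SepInt K) z)).degree := by
    have hint : IsIntegral 𝓀[K] (IsLocalRing.residue (SepInt K) z) := residue_isIntegralElem z
    calc (Q.map (IsLocalRing.residue 𝒪[K])).degree ≤ Q.degree := degree_map_le
      _ = q'.degree := degree_toSubring _ _ _
      _ = q.degree := degree_C_mul (inv_ne_zero ha)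
      _ < (minpoly K ζ).degree := hqd
      _ ≤ _ := by
        rw [degree_eq_natDegree (minpoly.ne_zero hintζ), degree_eq_natDegree (minpoly.ne_zero hint)]
        exact_mod_cast natDegree_minpoly_le_residue (z := z) hn hζ
  have hne : aeval (IsLocalRing.residue (SepInt K) z) (Q.map (IsLocalRing.residue 𝒪[K])) ≠ 0 := by
    intro h
    exact absurd hdeg (not_lt.mpr (minpoly.degree_le_of_ne_zero _ _ hQ0 h))
  have h1 : sepAbs K (aeval ζ q') = 1 := by
    rw [← hQ]
    refine le_antisymm ?_ ?_
    · rw [← coe_eval₂_intMap Q z]; exact (Q.eval₂ (intMap K) z).2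
    · rw [← not_lt, ← coe_eval₂_intMap Q z, ← residue_eq_zero_iff, ← eval₂_residue]
      exact hne
  refine ⟨-normVal K a, ?_⟩
  have h2 : y = algebraMap K (Sep K) a * aeval ζ q' := by
    rw [map_mul, hq, aeval_C, ← mul_assoc, ← map_mul, mul_inv_cancel₀ ha, map_one, one_mul]
  rw [h2, map_mul, h1, mul_one, sepAbs_algebraMap ha]
  push_cast
  rfl

end Unramified

/-! ### The inertia group -/

section Tame
open IntermediateField
variable {K : Type*} [Field K] [ValuativeRel K] [TopologicalSpace K] [IsNonarchimedeanLocalField K]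

variable (K) in
/-- The inertia group, as the group of automorphisms that act trivially on the residue field
of `K^sep`. -/
def inertiaGroup : Subgroup (AbsGal K) where
  carrier := {σ | ∀ x : Sep K, sepAbs K x ≤ 1 → sepAbs K (σ x - x) < 1}
  one_mem' := fun x _ => by simp
  mul_mem' := by
    intro σ τ hσ hτ x hx
    have h1 := hσ (τ x) ((sepAbs_aut τ x).le.trans hx)
    have h2 := hτ x hx
    have : (σ * τ) x - x = (σ (τ x) - τ x) + (τ x - x) := by
      rw [AlgEquiv.mul_apply]; ring
    rw [this]
    exact Valuation.map_add_lt _ h1 h2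
  inv_mem' := by
    intro σ hσ x hx
    have h1 := hσ (σ⁻¹ x) ((sepAbs_aut σ⁻¹ x).le.trans hx)
    rw [← AlgEquiv.mul_apply, mul_inv_cancel, AlgEquiv.one_apply] at h1
    rwa [Valuation.map_sub_swap]

theorem mem_inertiaGroup {σ : AbsGal K} :
    σ ∈ inertiaGroup K ↔ ∀ x : Sep K, sepAbs K x ≤ 1 → sepAbs K (σ x - x) < 1 := Iff.rfl

theorem mem_inertiaGroup_iff_fixes {σ : AbsGal K} : σ ∈ inertiaGroup K ↔
    ∀ (n : ℕ) (ζ : Sep K), sepAbs K (n : Sep K) = 1 → ζ ^ n = 1 → σ ζ = ζ := by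
  constructor
  · intro h n ζ hn hζ
    refine eq_of_pow_of_sepAbs_sub_lt hn (by rw [← map_pow, hζ, map_one]) hζ (h ζ ?_)
    exact (sepAbs_eq_one_of_pow (ne_zero_of_sepAbs hn) hζ).le
  · intro h x hx
    rcases hx.lt_or_eq with hx | hx
    · exact Valuation.map_sub_lt _ ((sepAbs_aut σ x).trans_lt hx) hx
    · obtain ⟨n, ζ, hn, hζ, hxζ⟩ := exists_root_of_unity_sub_lt hx
      have : σ x - x = σ (x - ζ) - (x - ζ) := by
        rw [map_sub, h n ζ hn hζ]; ring
      rw [this]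
      exact Valuation.map_sub_lt _ ((sepAbs_aut σ _).trans_lt hxζ) hxζ

theorem inertiaGroup_eq_fixingSubgroup : inertiaGroup K =
    (adjoin K {ζ : Sep K | ∃ n : ℕ, sepAbs K (n : Sep K) = 1 ∧ ζ ^ n = 1}).fixingSubgroup := by
  ext σ
  rw [mem_inertiaGroup_iff_fixes, IntermediateField.mem_fixingSubgroup_iff]
  constructor
  · intro h x hx
    induction hx using adjoin_induction with
    | mem x hx => obtain ⟨n, hn, hx⟩ := hx; exact h n x hn hx
    | algebraMap a => exact σ.commutes a
    | add x y _ _ hx hy => rw [map_add, hx, hy]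
    | inv x _ hx => rw [map_inv₀, hx]
    | mul x y _ _ hx hy => rw [map_mul, hx, hy]
  · intro h n ζ hn hζ
    exact h ζ (subset_adjoin _ _ ⟨n, hn, hζ⟩)

theorem isClosed_inertiaGroup : IsClosed (inertiaGroup K : Set (AbsGal K)) := by
  rw [inertiaGroup_eq_fixingSubgroup]
  exact InfiniteGalois.fixingSubgroup_isClosed _

theorem sepAbs_natCast_prod {ι : Type*} (s : Finset ι) (m : ι → ℕ)
    (h : ∀ i ∈ s, sepAbs K (m i : Sep K) = 1) : sepAbs K ((∏ i ∈ s, m i : ℕ) : Sep K) = 1 := by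
  rw [Nat.cast_prod, map_prod]
  exact Finset.prod_eq_one h

/-- The elements fixed by the inertia group have integral valuation: the fixed field is
generated by roots of unity of order prime to the residue characteristic. -/
theorem exists_sepAbs_eq_exp_of_fixed {y : Sep K} (hy : ∀ σ ∈ inertiaGroup K, σ y = y)
    (hy0 : y ≠ 0) : ∃ k : ℤ, (sepAbs K y : ℝ) = Real.exp k := by
  have hmem : y ∈ adjoin K {ζ : Sep K | ∃ n : ℕ, sepAbs K (n : Sep K) = 1 ∧ ζ ^ n = 1} := by
    rw [← InfiniteGalois.fixedField_fixingSubgroup (adjoin K _), ← inertiaGroup_eq_fixingSubgroup,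
      mem_fixedField_iff]
    exact hy
  obtain ⟨T, hT, hyT⟩ := exists_finset_of_mem_adjoin hmem
  have hT' : ∀ ζ : Sep K, ∃ n : ℕ, ζ ∈ T → sepAbs K (n : Sep K) = 1 ∧ ζ ^ n = 1 := fun ζ => by
    by_cases h : ζ ∈ T
    · obtain ⟨n, hn⟩ := hT h
      exact ⟨n, fun _ => hn⟩
    · exact ⟨0, fun h' => absurd h' h⟩
  choose m hm using hT'
  have hN := sepAbs_natCast_prod T m fun i hi => (hm i hi).1
  obtain ⟨ξ, hξ⟩ := exists_isPrimitiveRoot (natCast_ne_zero_of_sepAbs hN)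
  have hN0 := ne_zero_of_sepAbs hN
  have : NeZero (∏ i ∈ T, m i) := ⟨hN0⟩
  refine exists_sepAbs_eq_exp_of_mem_adjoin hN hξ.pow_eq_one (adjoin_le_iff.mpr ?_ hyT) hy0
  intro ζ hζ
  obtain ⟨i, -, hi⟩ := hξ.eq_pow_of_pow_eq_one (ξ := ζ) (by
    obtain ⟨c, hc⟩ := Finset.dvd_prod_of_mem m hζ
    rw [hc, pow_mul, (hm ζ hζ).2, one_pow])
  rw [← hi]
  exact pow_mem (mem_adjoin_simple_self K ξ) i

/-! ### Tame characters -/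

variable (K) in
/-- A uniformizer of `K`. -/
noncomputable def unif : K := (exists_uniformizer K).choose

theorem unif_ne_zero : unif K ≠ 0 := (exists_uniformizer K).choose_spec.1

theorem sepAbs_unif : (sepAbs K (algebraMap K (Sep K) (unif K)) : ℝ) = Real.exp (-1) := by
  rw [sepAbs_algebraMap unif_ne_zero]
  have := (exists_uniformizer K).choose_spec.2
  rw [unif, this, Int.cast_one]

theorem exists_tameRoot {m : ℕ} (hm : sepAbs K (m : Sep K) = 1) :
    ∃ x : Sep K, x ^ m = algebraMap K (Sep K) (unif K) := by
  have : NeZero (m : Sep K) := ⟨natCast_ne_zero_of_sepAbs hm⟩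
  exact IsSepClosed.exists_pow_nat_eq _ m

theorem tameRoot_ne_zero {m : ℕ} (hm : m ≠ 0) {x : Sep K}
    (hx : x ^ m = algebraMap K (Sep K) (unif K)) : x ≠ 0 := by
  rintro rfl
  rw [zero_pow hm] at hx
  exact unif_ne_zero ((map_eq_zero _).mp hx.symm)

theorem sepAbs_tameRoot {m : ℕ} (hm : m ≠ 0) {x : Sep K}
    (hx : x ^ m = algebraMap K (Sep K) (unif K)) : (sepAbs K x : ℝ) = Real.exp (-(1 / m)) := by
  have h : (sepAbs K x : ℝ) ^ m = Real.exp (-(1 / m)) ^ m := by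
    rw [← Real.exp_nat_mul, ← NNReal.coe_pow, ← map_pow, hx, sepAbs_unif]
    congr 1
    have : (m : ℝ) ≠ 0 := Nat.cast_ne_zero.mpr hm
    field_simp
  exact (pow_left_inj₀ (NNReal.coe_nonneg _) (Real.exp_nonneg _) hm).mp h

theorem aut_div_pow_eq_one (σ : AbsGal K) {m : ℕ} (hm : m ≠ 0) {x : Sep K}
    (hx : x ^ m = algebraMap K (Sep K) (unif K)) : (σ x / x) ^ m = 1 := by
  rw [div_pow, ← map_pow, hx, AlgEquiv.commutes]
  exact div_self (by rw [← hx]; exact pow_ne_zero _ (tameRoot_ne_zero hm hx))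

/-- If two nonzero elements have the same absolute value, then an element of the inertia group
multiplies them by congruent factors. -/
theorem sepAbs_div_sub_div_lt {σ : AbsGal K} (hσ : σ ∈ inertiaGroup K) {x y : Sep K}
    (hx : x ≠ 0) (hy : y ≠ 0) (hxy : sepAbs K x = sepAbs K y) :
    sepAbs K (σ x / x - σ y / y) < 1 := by
  have hy' : sepAbs K y ≠ 0 := by simpa using hy
  have hu : sepAbs K (x / y) = 1 := by rw [map_div₀, hxy, div_self hy']
  have hsy : sepAbs K (σ y / y) = 1 := by rw [map_div₀, sepAbs_aut, div_self hy']
  have : σ x / x - σ y / y = (σ y / y) * ((σ (x / y) - x / y) / (x / y)) := by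
    have : σ y ≠ 0 := by simpa using hy
    rw [map_div₀]
    field_simp
  rw [this, map_mul, hsy, one_mul, map_div₀, hu, div_one]
  exact hσ _ hu.le

theorem tame_div_eq {σ : AbsGal K} (hσ : σ ∈ inertiaGroup K) {m : ℕ}
    (hm : sepAbs K (m : Sep K) = 1) {x y : Sep K}
    (hx : x ^ m = algebraMap K (Sep K) (unif K)) (hy : y ^ m = algebraMap K (Sep K) (unif K)) :
    σ x / x = σ y / y := by
  have hm0 := ne_zero_of_sepAbs hm
  refine eq_of_pow_of_sepAbs_sub_lt hm (aut_div_pow_eq_one σ hm0 hx) (aut_div_pow_eq_one σ hm0 hy)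
    (sepAbs_div_sub_div_lt hσ (tameRoot_ne_zero hm0 hx) (tameRoot_ne_zero hm0 hy) ?_)
  ext
  rw [sepAbs_tameRoot hm0 hx, sepAbs_tameRoot hm0 hy]

/-- The tame character `σ ↦ σ(x) / x` of the inertia group, where `x` is an `m`-th root of a
uniformizer and `m` is prime to the residue characteristic. -/
noncomputable def tameChar {m : ℕ} (hm : sepAbs K (m : Sep K) = 1) :
    inertiaGroup K →* (Sep K)ˣ where
  toFun σ := Units.mk0 ((σ : AbsGal K) (exists_tameRoot hm).choose / (exists_tameRoot hm).choose)
    (by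
      have := tameRoot_ne_zero (ne_zero_of_sepAbs hm) (exists_tameRoot hm).choose_spec
      exact div_ne_zero (by simpa using this) this)
  map_one' := by
    refine Units.ext ?_
    exact div_self (tameRoot_ne_zero (ne_zero_of_sepAbs hm) (exists_tameRoot hm).choose_spec)
  map_mul' σ τ := by
    refine Units.ext ?_
    set x := (exists_tameRoot hm).choose
    have hx : x ^ m = algebraMap K (Sep K) (unif K) := (exists_tameRoot hm).choose_spec
    have hx0 := tameRoot_ne_zero (ne_zero_of_sepAbs hm) hx
    have h1 := mem_inertiaGroup_iff_fixes.mp σ.2 m _ hm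
      (aut_div_pow_eq_one (τ : AbsGal K) (ne_zero_of_sepAbs hm) hx)
    have hσ0 : (σ : AbsGal K) x ≠ 0 := by simpa using hx0
    rw [map_div₀, div_eq_iff hσ0] at h1
    change (σ : AbsGal K) ((τ : AbsGal K) x) / x =
      ((σ : AbsGal K) x / x) * ((τ : AbsGal K) x / x)
    rw [h1]
    ring

theorem tameChar_eq {m : ℕ} (hm : sepAbs K (m : Sep K) = 1) (σ : inertiaGroup K) {x : Sep K}
    (hx : x ^ m = algebraMap K (Sep K) (unif K)) :
    (tameChar hm σ : Sep K) = (σ : AbsGal K) x / x :=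
  tame_div_eq σ.2 hm (exists_tameRoot hm).choose_spec hx

theorem tameChar_pow {m : ℕ} (hm : sepAbs K (m : Sep K) = 1) (σ : inertiaGroup K) :
    tameChar hm σ ^ m = 1 := by
  refine Units.ext ?_
  exact aut_div_pow_eq_one _ (ne_zero_of_sepAbs hm) (exists_tameRoot hm).choose_spec

theorem sepAbs_natCast_of_mul {a b : ℕ} (h : sepAbs K ((a * b : ℕ) : Sep K) = 1) :
    sepAbs K (a : Sep K) = 1 := by
  refine le_antisymm (sepAbs_natCast_le_one a) (not_lt.mp fun ha => ?_)
  rw [Nat.cast_mul, map_mul] at h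
  exact absurd h (mul_lt_one_of_lt_of_le ha (sepAbs_natCast_le_one b)).ne

theorem tameChar_mul_pow {a b : ℕ} (hab : sepAbs K ((a * b : ℕ) : Sep K) = 1)
    (ha : sepAbs K (a : Sep K) = 1) (σ : inertiaGroup K) :
    tameChar hab σ ^ b = tameChar ha σ := by
  obtain ⟨x, hx⟩ := exists_tameRoot hab
  refine Units.ext ?_
  have hx' : (x ^ b) ^ a = algebraMap K (Sep K) (unif K) := by rw [← pow_mul, mul_comm, hx]
  rw [Units.val_pow_eq_pow_val, tameChar_eq hab σ hx, tameChar_eq ha σ hx', map_pow, div_pow]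

/-- Each tame character `I → μ_m` takes a primitive root of unity as a value:
this expresses that adjoining an `m`-th root of a uniformizer is totally ramified. -/
theorem exists_tameChar_isPrimitiveRoot {m : ℕ} (hm : sepAbs K (m : Sep K) = 1) :
    ∃ σ : inertiaGroup K, IsPrimitiveRoot (tameChar hm σ) m := by
  have hm0 := ne_zero_of_sepAbs hm
  have : NeZero m := ⟨hm0⟩
  let H := (tameChar hm).range
  have hfin : Finite H := by
    have hle : H ≤ rootsOfUnity m (Sep K) := by
      rintro _ ⟨σ, rfl⟩
      exact (mem_rootsOfUnity _ _).mpr (tameChar_pow hm σ)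
    exact Finite.of_injective _ (Subgroup.inclusion_injective hle)
  obtain ⟨⟨g, hgH⟩, hg⟩ := IsCyclic.exists_generator (α := H)
  obtain ⟨σ, rfl⟩ := hgH
  refine ⟨σ, ?_⟩
  -- `x ^ c` is fixed by inertia, so its valuation `c / m` is an integer
  set c := orderOf (tameChar hm σ) with hc
  have hall : ∀ τ : inertiaGroup K, tameChar hm τ ^ c = 1 := by
    intro τ
    obtain ⟨k, hk⟩ := Subgroup.mem_zpowers_iff.mp (hg ⟨tameChar hm τ, τ, rfl⟩)
    have hk' : tameChar hm σ ^ k = tameChar hm τ := congrArg Subtype.val hk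
    rw [← hk', ← zpow_natCast, ← zpow_mul, mul_comm, zpow_mul, zpow_natCast, pow_orderOf_eq_one,
      one_zpow]
  have hcm : c ∣ m := orderOf_dvd_of_pow_eq_one (tameChar_pow hm σ)
  obtain ⟨x, hx⟩ := exists_tameRoot hm
  have hx0 := tameRoot_ne_zero hm0 hx
  obtain ⟨k, hk⟩ := exists_sepAbs_eq_exp_of_fixed (y := x ^ c) (by
    intro τ hτ
    have h := congrArg Units.val (hall ⟨τ, hτ⟩)
    rw [Units.val_pow_eq_pow_val, tameChar_eq hm _ hx, div_pow, ← map_pow, Units.val_one] at h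
    exact (div_eq_one_iff_eq (pow_ne_zero _ hx0)).mp h) (pow_ne_zero _ hx0)
  rw [map_pow, NNReal.coe_pow, sepAbs_tameRoot hm0 hx, ← Real.exp_nat_mul, Real.exp_eq_exp] at hk
  have hmR : (m : ℝ) ≠ 0 := Nat.cast_ne_zero.mpr hm0
  have hkc : (c : ℤ) = m * (-k) := by
    have : (c : ℝ) = m * (-k) := by
      rw [← hk]; field_simp
    exact_mod_cast this
  have hmc : m ∣ c := Int.natCast_dvd_natCast.mp ⟨_, hkc⟩
  exact IsPrimitiveRoot.iff_orderOf.mpr (Nat.dvd_antisymm hcm hmc)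

end Tame

/-! ### The wild inertia group -/

section Wild
open IntermediateField
variable {K : Type*} [Field K] [ValuativeRel K] [TopologicalSpace K] [IsNonarchimedeanLocalField K]

theorem sepAbs_mul_sub_one_lt {a b : Sep K} (ha : sepAbs K (a - 1) < 1)
    (hb : sepAbs K (b - 1) < 1) : sepAbs K (a * b - 1) < 1 := by
  have ha1 : sepAbs K a ≤ 1 := by
    have : a = (a - 1) + 1 := by ring
    rw [this]
    exact (Valuation.map_add _ _ _).trans (max_le ha.le (map_one _).le)
  have : a * b - 1 = a * (b - 1) + (a - 1) := by ring
  rw [this]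
  refine Valuation.map_add_lt _ ?_ ha
  rw [map_mul]
  exact mul_lt_one_of_nonneg_of_lt_one_right ha1 zero_le hb

variable (K) in
/-- The wild inertia group, as the group of automorphisms `σ` with `σ(x) / x ≡ 1` for all
nonzero `x`. -/
def wildGroup : Subgroup (AbsGal K) where
  carrier := {σ | ∀ x : Sep K, x ≠ 0 → sepAbs K (σ x / x - 1) < 1}
  one_mem' := fun x hx => by simp [div_self hx]
  mul_mem' := by
    intro σ τ hσ hτ x hx
    have hτx : τ x ≠ 0 := by simpa using hx
    have h := sepAbs_mul_sub_one_lt (hσ (τ x) hτx) (hτ x hx)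
    rwa [div_mul_div_cancel₀ hτx] at h
  inv_mem' := by
    intro σ hσ x hx
    have hx' : σ⁻¹ x ≠ 0 := by simpa using hx
    have h := hσ (σ⁻¹ x) hx'
    rw [← AlgEquiv.mul_apply, mul_inv_cancel, AlgEquiv.one_apply] at h
    have habs : sepAbs K (σ⁻¹ x / x) = 1 := by
      rw [map_div₀, sepAbs_aut, div_self (by simpa using hx)]
    have : σ⁻¹ x / x - 1 = -((σ⁻¹ x / x) * (x / σ⁻¹ x - 1)) := by
      field_simp; ring
    rwa [this, Valuation.map_neg, map_mul, habs, one_mul]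

theorem wildGroup_le_inertiaGroup : wildGroup K ≤ inertiaGroup K := by
  intro σ hσ x hx
  rcases eq_or_ne x 0 with rfl | hx0
  · simp
  · have : σ x - x = x * (σ x / x - 1) := by field_simp
    rw [this, map_mul]
    exact mul_lt_one_of_nonneg_of_lt_one_right hx zero_le (hσ x hx0)

/-- In residue characteristic `p`, a unit whose `p`-power is congruent to `1` is congruent
to `1`. -/
theorem sepAbs_sub_one_lt_of_pow {p : ℕ} (hp : p.Prime) [CharP (SepRes K) p] {a : Sep K}
    (ha : sepAbs K a = 1) {k : ℕ} (h : sepAbs K (a ^ p ^ k - 1) < 1) : sepAbs K (a - 1) < 1 := by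
  have : Fact p.Prime := ⟨hp⟩
  let z : SepInt K := ⟨a, ha.le⟩
  have h1 : IsLocalRing.residue (SepInt K) (z ^ p ^ k) = IsLocalRing.residue (SepInt K) 1 := by
    rw [residue_eq_iff, SubmonoidClass.coe_pow, OneMemClass.coe_one]
    exact h
  have h2 : IsLocalRing.residue (SepInt K) z = IsLocalRing.residue (SepInt K) 1 := by
    rw [map_pow, map_one] at h1
    rw [map_one]
    refine iterateFrobenius_inj (SepRes K) p k ?_
    rw [iterateFrobenius_def, iterateFrobenius_def, h1, one_pow]
  rw [residue_eq_iff, OneMemClass.coe_one] at h2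
  exact h2

/-- The wild inertia group is the common kernel of the tame characters: up to a power of the
residue characteristic, every element of `K^sep` is the product of a power of a tame root, a root
of unity and an element congruent to `1`. -/
theorem mem_wildGroup_of_tameChar {σ : AbsGal K} (hσ : σ ∈ inertiaGroup K)
    (h : ∀ (m : ℕ) (hm : sepAbs K (m : Sep K) = 1), tameChar hm ⟨σ, hσ⟩ = 1) :
    σ ∈ wildGroup K := by
  intro x hx
  obtain ⟨p, hp, hchar⟩ := exists_residue_char (K := K)
  have hb : (minpoly K x).natDegree ≠ 0 :=
    (minpoly.natDegree_pos (Algebra.IsIntegral.isIntegral x)).ne'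
  have hxabs := sepAbs_eq_exp hx
  set a := normVal K ((minpoly K x).coeff 0)
  -- `v(x) = a / (p ^ k * m)`, so that `x ^ p ^ k` has the valuation of a power of a tame root
  obtain ⟨k, m, hpm, hbm⟩ := Nat.exists_eq_pow_mul_and_not_dvd hb p hp.ne_one
  have hm : sepAbs K (m : Sep K) = 1 := by
    rw [← natCast_residue_ne_zero_iff, Ne, CharP.cast_eq_zero_iff (SepRes K) p]
    exact hpm
  have hm0 := ne_zero_of_sepAbs hm
  obtain ⟨y, hy⟩ := exists_tameRoot hm
  have hy0 := tameRoot_ne_zero hm0 hy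
  have hσy : σ y = y := by
    have h1 := congrArg Units.val (h m hm)
    rw [tameChar_eq hm _ hy, Units.val_one] at h1
    exact (div_eq_one_iff_eq hy0).mp h1
  have hxy : sepAbs K (x ^ p ^ k) = sepAbs K (y ^ a) := by
    ext
    rw [map_pow, map_zpow₀, NNReal.coe_pow, NNReal.coe_zpow, sepAbs_tameRoot hm0 hy, hxabs, hbm,
      ← Real.exp_nat_mul, ← Real.rpow_intCast, ← Real.exp_mul]
    congr 1
    have : (m : ℝ) ≠ 0 := Nat.cast_ne_zero.mpr hm0
    have : (p : ℝ) ≠ 0 := Nat.cast_ne_zero.mpr hp.ne_zero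
    push_cast
    field_simp
  have hya : y ^ a ≠ 0 := zpow_ne_zero _ hy0
  have key := sepAbs_div_sub_div_lt hσ (pow_ne_zero (p ^ k) hx) hya hxy
  rw [map_zpow₀, hσy, div_self hya, map_pow, ← div_pow] at key
  refine sepAbs_sub_one_lt_of_pow hp ?_ key
  rw [map_div₀, sepAbs_aut, div_self (by simpa using hx)]

/-- An open neighbourhood of the wild inertia group contains the kernel of a tame character, by
compactness of the inertia group. -/
theorem exists_tameChar_ker_subset {U : Set (AbsGal K)} (hU : IsOpen U)
    (hWU : (wildGroup K : Set (AbsGal K)) ⊆ U) :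
    ∃ (m : ℕ) (hm : sepAbs K (m : Sep K) = 1), ∀ σ : inertiaGroup K,
      tameChar hm σ = 1 → (σ : AbsGal K) ∈ U := by
  classical
  let ι := {m : ℕ // sepAbs K (m : Sep K) = 1}
  let x : ι → Sep K := fun i => (exists_tameRoot i.2).choose
  have hx : ∀ i : ι, x i ^ i.1 = algebraMap K (Sep K) (unif K) := fun i =>
    (exists_tameRoot i.2).choose_spec
  let C : ι → Set (AbsGal K) := fun i => (K⟮x i⟯).fixingSubgroup
  have hC : ∀ i, IsClosed (C i) := fun i => InfiniteGalois.fixingSubgroup_isClosed _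
  have hmemC : ∀ i σ, σ ∈ C i ↔ σ (x i) = x i := by
    intro i σ
    change σ ∈ (K⟮x i⟯).fixingSubgroup ↔ _
    rw [IntermediateField.mem_fixingSubgroup_iff]
    refine ⟨fun h => h _ (mem_adjoin_simple_self K _), fun h y hy => ?_⟩
    induction hy using adjoin_induction with
    | mem y hy => rw [Set.mem_singleton_iff.mp hy, h]
    | algebraMap a => exact σ.commutes a
    | add x y _ _ hx hy => rw [map_add, hx, hy]
    | inv x _ hx => rw [map_inv₀, hx]
    | mul x y _ _ hx hy => rw [map_mul, hx, hy]
  have hIU : IsCompact ((inertiaGroup K : Set (AbsGal K)) \ U) :=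
    (isClosed_inertiaGroup.isCompact).diff hU
  obtain ⟨t, ht⟩ := hIU.elim_finite_subfamily_closed C hC (by
    rw [Set.eq_empty_iff_forall_notMem]
    rintro σ ⟨⟨hσ, hσU⟩, hσC⟩
    refine hσU (hWU (mem_wildGroup_of_tameChar hσ fun m hm => ?_))
    have h := (hmemC ⟨m, hm⟩ σ).mp (Set.mem_iInter.mp hσC ⟨m, hm⟩)
    refine Units.ext ?_
    rw [tameChar_eq hm _ (hx ⟨m, hm⟩), Units.val_one]
    exact (div_eq_one_iff_eq (tameRoot_ne_zero (ne_zero_of_sepAbs hm) (hx ⟨m, hm⟩))).mpr h)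
  have hM := sepAbs_natCast_prod t (fun i => i.1) fun i _ => i.2
  refine ⟨_, hM, fun σ hσ => ?_⟩
  by_contra hσU
  have : (σ : AbsGal K) ∈ (((inertiaGroup K : Set (AbsGal K)) \ U) ∩ ⋂ i ∈ t, C i) := by
    refine ⟨⟨σ.2, hσU⟩, Set.mem_iInter₂.mpr fun i hi => (hmemC i _).mpr ?_⟩
    obtain ⟨b, hb⟩ := Finset.dvd_prod_of_mem (fun i : ι => i.1) hi
    have hib : sepAbs K ((i.1 * b : ℕ) : Sep K) = 1 := by rw [← hb]; exact hM
    have h1 : tameChar hib σ = 1 := by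
      have : ∀ (n : ℕ) (hn : sepAbs K (n : Sep K) = 1), n = i.1 * b → tameChar hn σ = 1 →
          tameChar hib σ = 1 := by
        rintro n hn rfl h; exact h
      exact this _ hM hb hσ
    have h2 := congrArg Units.val (tameChar_mul_pow hib i.2 σ)
    rw [h1, one_pow, Units.val_one, tameChar_eq i.2 σ (hx i)] at h2
    exact (div_eq_one_iff_eq (tameRoot_ne_zero (ne_zero_of_sepAbs i.2) (hx i))).mp h2.symm
  rw [ht] at this
  exact this

/-- A subgroup `N` of a group `I` that contains the kernel of a homomorphism onto `μ_m` is the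
kernel of a power of this homomorphism. -/
theorem mem_iff_pow_eq_one_of_ker_le {I F : Type*} [Group I] [Field F] {m : ℕ} (hm : m ≠ 0)
    (θ : I →* Fˣ) (hθ : ∀ σ, θ σ ^ m = 1) (hprim : ∃ σ, IsPrimitiveRoot (θ σ) m)
    (N : Subgroup I) (hN : θ.ker ≤ N) :
    ∃ b, N.index * b = m ∧ ∀ σ, σ ∈ N ↔ θ σ ^ b = 1 := by
  classical
  have : NeZero m := ⟨hm⟩
  obtain ⟨σ₀, hσ₀⟩ := hprim
  have hR : θ.range = rootsOfUnity m F := by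
    apply le_antisymm
    · rintro _ ⟨σ, rfl⟩
      exact (mem_rootsOfUnity _ _).mpr (hθ σ)
    · intro u hu
      obtain ⟨i, -, hi⟩ := hσ₀.eq_pow_of_mem_rootsOfUnity hu
      exact ⟨σ₀ ^ i, by rw [map_pow, hi]⟩
  have hcard : Nat.card θ.range = m := by
    rw [hR]
    exact (IsPrimitiveRoot.coe_units_iff.mpr hσ₀).card_rootsOfUnity
  have : Finite θ.range := Nat.finite_of_card_ne_zero (by rw [hcard]; exact hm)
  have := Fintype.ofFinite θ.range
  let S : Subgroup θ.range := N.map θ.rangeRestrict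
  have hker : θ.rangeRestrict.ker ≤ N := by rwa [MonoidHom.ker_rangeRestrict]
  have hSidx : S.index = N.index := N.index_map_eq θ.rangeRestrict_surjective hker
  refine ⟨Nat.card S, by rw [← hSidx, mul_comm, Subgroup.card_mul_index, hcard], fun σ => ?_⟩
  have hmem : σ ∈ N ↔ θ.rangeRestrict σ ∈ S := by
    rw [← Subgroup.mem_comap, Subgroup.comap_map_eq_self hker]
  -- in a cyclic group a subgroup consists of all elements of order dividing its order
  have hsub : (Finset.univ.filter fun g : θ.range => g ∈ S) ⊆
      Finset.univ.filter fun g : θ.range => g ^ Nat.card S = 1 := by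
    intro g hg
    rw [Finset.mem_filter] at hg ⊢
    have := congrArg Subtype.val (pow_card_eq_one' (x := (⟨g, hg.2⟩ : S)))
    exact ⟨hg.1, this⟩
  have heq := Finset.eq_of_subset_of_card_le hsub (by
    refine (IsCyclic.card_pow_eq_one_le Nat.card_pos).trans ?_
    rw [← Fintype.card_subtype, Nat.card_eq_fintype_card])
  have hiff : θ.rangeRestrict σ ∈ S ↔ θ.rangeRestrict σ ^ Nat.card S = 1 := by
    simpa using congrArg (fun s : Finset θ.range => θ.rangeRestrict σ ∈ s) heq
  rw [hmem, hiff, Subtype.ext_iff]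
  rfl

end Wild

/-! ### Ramification groups in lower numbering -/

section Lower
open IntermediateField
variable {K : Type*} [Field K] [ValuativeRel K] [TopologicalSpace K] [IsNonarchimedeanLocalField K]

theorem exists_sepAbs_eq_exp_div_finrank (L : IntermediateField K (Sep K)) [FiniteDimensional K L]
    {x : Sep K} (hx : x ∈ L) (hx0 : x ≠ 0) :
    ∃ a : ℤ, (sepAbs K x : ℝ) = Real.exp (-((a : ℝ) / (Module.finrank K L : ℝ))) := by
  obtain ⟨c, hc⟩ : (minpoly K x).natDegree ∣ Module.finrank K L := by
    have h := minpoly.degree_dvd (K := K) (x := (⟨x, hx⟩ : L)) (Algebra.IsIntegral.isIntegral _)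
    rwa [IntermediateField.minpoly_eq] at h
  refine ⟨normVal K ((minpoly K x).coeff 0) * c, ?_⟩
  have hd : ((Module.finrank K L : ℕ) : ℝ) ≠ 0 := Nat.cast_ne_zero.mpr Module.finrank_pos.ne'
  rw [hc] at hd ⊢
  rw [sepAbs_eq_exp hx0]
  push_cast at hd ⊢
  have h1 := left_ne_zero_of_mul hd
  have h2 := right_ne_zero_of_mul hd
  congr 2
  field_simp

/-- The valuations of the elements of a finite extension are discrete, so that the least positive
valuation is attained. -/
theorem isLeast_unifVal (L : IntermediateField K (Sep K)) [FiniteDimensional K L] :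
    IsLeast {r : ℝ | 0 < r ∧ ∃ x ∈ L, sepVal K x = (r : WithTop ℝ)} (unifVal L) := by
  classical
  set S := {r : ℝ | 0 < r ∧ ∃ x ∈ L, sepVal K x = (r : WithTop ℝ)} with hS
  set d := Module.finrank K L
  have hd : (0 : ℝ) < d := Nat.cast_pos.mpr Module.finrank_pos
  have hform : ∀ r ∈ S, ∃ a : ℕ, r = a / d := by
    rintro r ⟨hr, x, hxL, hx⟩
    rw [sepVal_eq_iff] at hx
    have hx0 : x ≠ 0 := by
      rintro rfl
      rw [map_zero] at hx
      exact (Real.exp_pos (-r)).ne hx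
    obtain ⟨a, ha⟩ := exists_sepAbs_eq_exp_div_finrank L hxL hx0
    rw [hx, Real.exp_eq_exp, neg_inj] at ha
    have ha0 : (0 : ℝ) ≤ a := by
      rw [ha] at hr
      exact ((div_pos_iff_of_pos_right hd).mp hr).le
    lift a to ℕ using (by exact_mod_cast ha0)
    exact ⟨a, by rw [ha, Int.cast_natCast]⟩
  have hne : ∃ a : ℕ, (a / d : ℝ) ∈ S := by
    have h1 : (1 : ℝ) ∈ S := ⟨one_pos, algebraMap K (Sep K) (unif K), L.algebraMap_mem _, by
      rw [sepVal_eq_iff, sepAbs_unif]⟩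
    obtain ⟨a, ha⟩ := hform 1 h1
    exact ⟨a, by rwa [← ha]⟩
  have hleast : IsLeast S (Nat.find hne / d) := by
    refine ⟨Nat.find_spec hne, fun r hr => ?_⟩
    obtain ⟨a, rfl⟩ := hform r hr
    have := Nat.find_min' hne hr
    gcongr
  have : unifVal L = Nat.find hne / d := hleast.csInf_eq
  rwa [this]

theorem unifVal_pos (L : IntermediateField K (Sep K)) [FiniteDimensional K L] : 0 < unifVal L :=
  (isLeast_unifVal L).1.1

theorem exists_uniformizer_of_finite (L : IntermediateField K (Sep K)) [FiniteDimensional K L] :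
    ∃ x ∈ L, (sepAbs K x : ℝ) = Real.exp (-unifVal L) := by
  obtain ⟨x, hx, h⟩ := (isLeast_unifVal L).1.2
  exact ⟨x, hx, sepVal_eq_iff.mp h⟩

theorem sepAbs_le_of_lt_one (L : IntermediateField K (Sep K)) [FiniteDimensional K L] {x : Sep K}
    (hx : x ∈ L) (h : sepAbs K x < 1) : (sepAbs K x : ℝ) ≤ Real.exp (-unifVal L) := by
  rcases eq_or_ne x 0 with rfl | hx0
  · simp [Real.exp_nonneg]
  have hpos := sepAbs_pos hx0
  have hlog : 0 < -Real.log (sepAbs K x) := by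
    have := Real.log_neg hpos (by exact_mod_cast h)
    linarith
  have := (isLeast_unifVal L).2 ⟨hlog, x, hx, sepVal_eq_log hx0⟩
  rw [← Real.log_le_iff_le_exp hpos]
  linarith

theorem sepAbs_lt_one_of_le (L : IntermediateField K (Sep K)) [FiniteDimensional K L] {x : Sep K}
    {c : ℝ} (hc : 0 < c) (h : (sepAbs K x : ℝ) ≤ Real.exp (-(c * unifVal L))) :
    sepAbs K x < 1 := by
  have : Real.exp (-(c * unifVal L)) < 1 := by
    rw [Real.exp_lt_one_iff]
    have := mul_pos hc (unifVal_pos L)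
    linarith
  exact_mod_cast h.trans_lt this

theorem exists_sepAbs_eq_zpow (L : IntermediateField K (Sep K)) [FiniteDimensional K L]
    {x : Sep K} (hx : x ∈ L) (hx0 : x ≠ 0) {ϖ : Sep K} (hϖL : ϖ ∈ L)
    (hϖ : (sepAbs K ϖ : ℝ) = Real.exp (-unifVal L)) :
    ∃ k : ℤ, sepAbs K x = sepAbs K (ϖ ^ k) := by
  have hu := unifVal_pos L
  have hϖ0 : ϖ ≠ 0 := by
    rintro rfl
    rw [map_zero] at hϖ
    exact (Real.exp_pos (-unifVal L)).ne hϖ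
  set v := -Real.log (sepAbs K x) with hv
  have hxv : (sepAbs K x : ℝ) = Real.exp (-v) := by
    rw [hv, neg_neg, Real.exp_log (sepAbs_pos hx0)]
  set k := ⌊v / unifVal L⌋ with hk
  refine ⟨k, ?_⟩
  have hϖk : (sepAbs K (ϖ ^ k) : ℝ) = Real.exp (-(k * unifVal L)) := by
    rw [map_zpow₀, NNReal.coe_zpow, hϖ, ← Real.rpow_intCast, ← Real.exp_mul]
    congr 1; ring
  have h1 : (k : ℝ) * unifVal L ≤ v := by
    have := Int.floor_le (v / unifVal L)
    rwa [le_div_iff₀ hu] at this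
  have h2 : v < (k + 1 : ℝ) * unifVal L := by
    have := Int.lt_floor_add_one (v / unifVal L)
    rwa [div_lt_iff₀ hu] at this
  have hq : (sepAbs K (x / ϖ ^ k) : ℝ) = Real.exp (-(v - k * unifVal L)) := by
    rw [map_div₀, NNReal.coe_div, hxv, hϖk, ← Real.exp_sub]
    congr 1; ring
  have hnot : ¬ sepAbs K (x / ϖ ^ k) < 1 := by
    intro hlt
    have := sepAbs_le_of_lt_one L (div_mem hx (zpow_mem hϖL k)) hlt
    rw [hq, Real.exp_le_exp] at this
    linarith
  have hle : sepAbs K (x / ϖ ^ k) ≤ 1 := by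
    have : (sepAbs K (x / ϖ ^ k) : ℝ) ≤ 1 := by
      rw [hq, Real.exp_le_one_iff]; linarith
    exact_mod_cast this
  have heq := le_antisymm hle (not_lt.mp hnot)
  rw [map_div₀, div_eq_one_iff_eq] at heq
  · exact heq
  · rw [map_zpow₀]
    exact zpow_ne_zero k (by simpa using hϖ0)

theorem mem_lowerRam_iff {L : IntermediateField K (Sep K)} {s : ℝ} {σ : L ≃ₐ[K] L} :
    σ ∈ lowerRam L s ↔ ∀ x : L, sepAbs K (x : Sep K) ≤ 1 →
      (sepAbs K ((σ x : Sep K) - (x : Sep K)) : ℝ) ≤ Real.exp (-((s + 1) * unifVal L)) := by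
  simp only [lowerRam, Set.mem_ofPred_eq, zero_le_sepVal_iff, le_sepVal_iff]

theorem restrict_mem_lowerRam_iff {L : IntermediateField K (Sep K)} [Normal K L] {s : ℝ}
    {σ : AbsGal K} : AlgEquiv.restrictNormalHom L σ ∈ lowerRam L s ↔
      ∀ x ∈ L, sepAbs K x ≤ 1 →
        (sepAbs K (σ x - x) : ℝ) ≤ Real.exp (-((s + 1) * unifVal L)) := by
  rw [mem_lowerRam_iff]
  constructor
  · intro h x hx hx1
    have := h ⟨x, hx⟩ hx1
    rwa [AlgEquiv.restrictNormalHom_apply] at this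
  · intro h x hx
    rw [AlgEquiv.restrictNormalHom_apply]
    exact h x x.2 hx

theorem lowerRam_antitone (L : IntermediateField K (Sep K)) [FiniteDimensional K L] :
    Antitone (lowerRam L) := by
  intro s t hst σ hσ
  rw [mem_lowerRam_iff] at hσ ⊢
  intro x hx
  refine (hσ x hx).trans (Real.exp_le_exp.mpr ?_)
  have := mul_le_mul_of_nonneg_right (add_le_add_left hst 1) (unifVal_pos L).le
  linarith

theorem sepAbs_algEquiv {L : IntermediateField K (Sep K)} [Normal K L] (σ : L ≃ₐ[K] L) (x : L) :
    sepAbs K (σ x : Sep K) = sepAbs K (x : Sep K) := by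
  obtain ⟨τ, rfl⟩ := AlgEquiv.restrictNormalHom_surjective (F := K) (K₁ := L) (Sep K) σ
  rw [AlgEquiv.restrictNormalHom_apply]
  exact sepAbs_aut τ x

/-- The ramification group in lower numbering as a subgroup. -/
def lowerRamGroup (L : IntermediateField K (Sep K)) [Normal K L] (s : ℝ) :
    Subgroup (L ≃ₐ[K] L) where
  carrier := lowerRam L s
  one_mem' := by
    rw [mem_lowerRam_iff]; intro x _
    simp [Real.exp_nonneg]
  mul_mem' := by
    intro σ τ hσ hτ
    rw [mem_lowerRam_iff] at hσ hτ ⊢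
    intro x hx
    have h1 := hσ (τ x) ((sepAbs_algEquiv τ x).le.trans hx)
    have : (((σ * τ) x : L) : Sep K) - x =
        ((σ (τ x) : Sep K) - (τ x : Sep K)) + ((τ x : Sep K) - x) := by
      rw [AlgEquiv.mul_apply]; ring
    rw [this]
    have h2 := (sepAbs K).map_add ((σ (τ x) : Sep K) - (τ x : Sep K)) ((τ x : Sep K) - x)
    exact (NNReal.coe_le_coe.mpr h2).trans (by rw [NNReal.coe_max]; exact max_le h1 (hτ x hx))
  inv_mem' := by
    intro σ hσ
    have hσ := mem_lowerRam_iff.mp hσ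
    change σ⁻¹ ∈ lowerRam L s
    rw [mem_lowerRam_iff]
    intro x hx
    have h1 := hσ (σ⁻¹ x) ((sepAbs_algEquiv σ⁻¹ x).le.trans hx)
    rw [← AlgEquiv.mul_apply, mul_inv_cancel, AlgEquiv.one_apply] at h1
    rwa [Valuation.map_sub_swap]

/-- The ramification groups of a finite Galois extension are eventually trivial. -/
theorem exists_lowerRam_eq_one (L : IntermediateField K (Sep K)) [FiniteDimensional K L] :
    ∃ T : ℝ, ∀ s, T ≤ s → lowerRam L s ⊆ {1} := by
  classical
  have key : ∀ σ : L ≃ₐ[K] L, ∃ T : ℝ, σ ≠ 1 → ∀ s, T ≤ s → σ ∉ lowerRam L s := by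
    intro σ
    by_cases hσ : σ = 1
    · exact ⟨0, fun h => absurd hσ h⟩
    obtain ⟨x, hx⟩ : ∃ x : L, σ x ≠ x := by
      by_contra! h
      exact hσ (AlgEquiv.ext h)
    -- one of `x` and `x⁻¹` is integral
    obtain ⟨y, hy1, hy⟩ : ∃ y : L, sepAbs K (y : Sep K) ≤ 1 ∧ σ y ≠ y := by
      have hx0 : (x : Sep K) ≠ 0 := by
        intro h
        have : x = 0 := Subtype.ext h
        exact hx (by rw [this, map_zero])
      rcases le_total (sepAbs K (x : Sep K)) 1 with h | h
      · exact ⟨x, h, hx⟩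
      · refine ⟨x⁻¹, ?_, ?_⟩
        · have : ((x⁻¹ : L) : Sep K) = (x : Sep K)⁻¹ := rfl
          rw [this, map_inv₀]
          exact inv_le_one_of_one_le₀ h
        · rw [map_inv₀]
          exact fun h => hx (inv_injective h)
    have hne : (σ y : Sep K) - y ≠ 0 := sub_ne_zero.mpr fun h => hy (Subtype.ext h)
    refine ⟨-Real.log (sepAbs K ((σ y : Sep K) - y)) / unifVal L, fun _ s hs hmem => ?_⟩
    have h1 := mem_lowerRam_iff.mp hmem y hy1
    rw [← Real.log_le_iff_le_exp (sepAbs_pos hne)] at h1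
    rw [div_le_iff₀ (unifVal_pos L)] at hs
    have := unifVal_pos L
    linarith
  choose T hT using key
  obtain ⟨M, hM⟩ := (Set.finite_range T).bddAbove
  refine ⟨M, fun s hs σ hσ => ?_⟩
  by_contra h
  exact hT σ h s ((hM ⟨σ, rfl⟩).trans hs) hσ

end Lower

/-! ### Ramification groups in upper numbering -/

section Upper
open IntermediateField
variable {K : Type*} [Field K] [ValuativeRel K] [TopologicalSpace K] [IsNonarchimedeanLocalField K]

section Herbrand
variable (L : IntermediateField K (Sep K))

theorem herbrand_zero : herbrand L 0 = 0 := intervalIntegral.integral_same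

variable [FiniteDimensional K L]

theorem card_lowerRam_antitone : Antitone fun s => (Nat.card (lowerRam L s) : ℝ) := fun _ _ h =>
  Nat.cast_le.mpr (Nat.card_mono (Set.toFinite _) (lowerRam_antitone L h))

theorem intervalIntegrable_herbrand (a b : ℝ) : IntervalIntegrable
    (fun x => (Nat.card (lowerRam L x) : ℝ) / (Nat.card (lowerRam L 0) : ℝ)) volume a b :=
  (Antitone.intervalIntegrable fun _ _ h =>
    div_le_div_of_nonneg_right (card_lowerRam_antitone L h) (Nat.cast_nonneg _))

theorem herbrand_sub (s t : ℝ) : herbrand L t - herbrand L s =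
    ∫ x in s..t, (Nat.card (lowerRam L x) : ℝ) / (Nat.card (lowerRam L 0) : ℝ) :=
  intervalIntegral.integral_interval_sub_left (intervalIntegrable_herbrand L _ _)
    (intervalIntegrable_herbrand L _ _)

variable [Normal K L]

theorem card_lowerRam_pos (s : ℝ) : 0 < Nat.card (lowerRam L s) :=
  Nat.card_pos_iff.mpr ⟨⟨1, (lowerRamGroup L s).one_mem⟩, inferInstance⟩

theorem div_card_le_herbrand_sub {s t : ℝ} (hst : s ≤ t) :
    (t - s) / Nat.card (lowerRam L 0) ≤ herbrand L t - herbrand L s := by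
  rw [herbrand_sub]
  have h := intervalIntegral.integral_mono_on hst
    (f := fun _ => 1 / (Nat.card (lowerRam L 0) : ℝ)) (by simp)
    (intervalIntegrable_herbrand L s t) (fun x _ => by
      have : (1 : ℝ) ≤ Nat.card (lowerRam L x) := by exact_mod_cast card_lowerRam_pos L x
      gcongr)
  rw [intervalIntegral.integral_const, smul_eq_mul] at h
  calc _ = (t - s) * (1 / (Nat.card (lowerRam L 0) : ℝ)) := by ring
    _ ≤ _ := h

theorem herbrand_strictMono : StrictMono (herbrand L) := by
  intro s t hst
  have h := div_card_le_herbrand_sub L hst.le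
  have h0 : (0 : ℝ) < Nat.card (lowerRam L 0) := Nat.cast_pos.mpr (card_lowerRam_pos L 0)
  have := div_pos (sub_pos.mpr hst) h0
  linarith

theorem herbrand_le_self {s : ℝ} (hs : 0 ≤ s) : herbrand L s ≤ s := by
  have h := intervalIntegral.integral_mono_on hs (intervalIntegrable_herbrand L 0 s)
    (g := fun _ => (1 : ℝ)) (by simp) (fun x hx => by
      have h0 : (0 : ℝ) < Nat.card (lowerRam L 0) := Nat.cast_pos.mpr (card_lowerRam_pos L 0)
      rw [div_le_one h0]
      exact card_lowerRam_antitone L hx.1)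
  rw [intervalIntegral.integral_const, smul_eq_mul, mul_one, sub_zero] at h
  exact h

theorem exists_herbrand_eq {u : ℝ} (hu : 0 ≤ u) : ∃ s, 0 ≤ s ∧ herbrand L s = u := by
  have hcont : Continuous (herbrand L) :=
    intervalIntegral.continuous_primitive (intervalIntegrable_herbrand L) 0
  have h0 : (0 : ℝ) < Nat.card (lowerRam L 0) := Nat.cast_pos.mpr (card_lowerRam_pos L 0)
  have hT : 0 ≤ u * Nat.card (lowerRam L 0) := mul_nonneg hu h0.le
  have h1 := div_card_le_herbrand_sub L hT
  rw [herbrand_zero, sub_zero, sub_zero, mul_div_cancel_right₀ _ h0.ne'] at h1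
  obtain ⟨s, hs, h⟩ := intermediate_value_Icc hT hcont.continuousOn
    ⟨by rw [herbrand_zero]; exact hu, h1⟩
  exact ⟨s, hs.1, h⟩

/-- Each group in upper numbering is the group in lower numbering at a unique index. -/
theorem upperRam_eq_lowerRam {s : ℝ} (hs : 0 ≤ s) : upperRam L (herbrand L s) = lowerRam L s := by
  ext σ
  constructor
  · rintro ⟨t, -, ht, hσ⟩
    rwa [← (herbrand_strictMono L).injective ht]
  · exact fun h => ⟨s, hs, rfl, h⟩

theorem upperRam_zero : upperRam L 0 = lowerRam L 0 := by
  have := upperRam_eq_lowerRam L (le_refl (0 : ℝ))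
  rwa [herbrand_zero] at this

theorem upperRam_antitone {u v : ℝ} (hu : 0 ≤ u) (huv : u ≤ v) : upperRam L v ⊆ upperRam L u := by
  obtain ⟨s, hs, rfl⟩ := exists_herbrand_eq L hu
  obtain ⟨t, ht, rfl⟩ := exists_herbrand_eq L (hu.trans huv)
  rw [upperRam_eq_lowerRam L hs, upperRam_eq_lowerRam L ht]
  exact lowerRam_antitone L ((herbrand_strictMono L).le_iff_le.mp huv)

theorem exists_upperRam_eq_one : ∃ T : ℝ, ∀ u, T ≤ u → upperRam L u ⊆ {1} := by
  obtain ⟨T, hT⟩ := exists_lowerRam_eq_one L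
  refine ⟨T, fun u hu σ hσ => ?_⟩
  obtain ⟨s, hs, rfl, hσ⟩ := hσ
  exact hT s (hu.trans (herbrand_le_self L hs)) hσ

end Herbrand

variable (K) in
/-- The ramification group of `K^sep|K` in upper numbering, as a subgroup. -/
def absUpperGroup {u : ℝ} (hu : 0 ≤ u) : Subgroup (AbsGal K) where
  carrier := absUpperRam K u
  one_mem' := by
    intro L _ _
    obtain ⟨s, hs, rfl⟩ := exists_herbrand_eq L hu
    rw [upperRam_eq_lowerRam L hs, map_one]
    exact (lowerRamGroup L s).one_mem
  mul_mem' := by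
    intro σ τ hσ hτ L _ _
    have h1 := hσ L
    have h2 := hτ L
    obtain ⟨s, hs, rfl⟩ := exists_herbrand_eq L hu
    rw [upperRam_eq_lowerRam L hs] at h1 h2 ⊢
    rw [map_mul]
    exact (lowerRamGroup L s).mul_mem h1 h2
  inv_mem' := by
    intro σ hσ L _ _
    have h1 := hσ L
    obtain ⟨s, hs, rfl⟩ := exists_herbrand_eq L hu
    rw [upperRam_eq_lowerRam L hs] at h1 ⊢
    rw [map_inv]
    exact (lowerRamGroup L s).inv_mem h1

theorem absUpperRam_antitone {u v : ℝ} (hu : 0 ≤ u) (huv : u ≤ v) :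
    absUpperRam K v ⊆ absUpperRam K u := fun _ hσ L _ _ => upperRam_antitone L hu huv (hσ L)

theorem inertia_eq : inertia K = inertiaGroup K := by
  ext σ
  have h0 : σ ∈ inertia K ↔ ∀ (L : IntermediateField K (Sep K)) [FiniteDimensional K L]
      [IsGalois K L], AlgEquiv.restrictNormalHom L σ ∈ lowerRam L 0 := by
    constructor
    · intro h L _ _
      rw [← upperRam_zero]; exact h L
    · intro h L _ _
      rw [upperRam_zero]; exact h L
  rw [h0, SetLike.mem_coe, mem_inertiaGroup]
  constructor
  · intro h x hx
    let L := FiniteGaloisIntermediateField.adjoin K {x}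
    have hxL : x ∈ L.toIntermediateField := FiniteGaloisIntermediateField.subset_adjoin K {x} rfl
    have := restrict_mem_lowerRam_iff.mp (h L.toIntermediateField) x hxL hx
    exact sepAbs_lt_one_of_le L.toIntermediateField (by norm_num) this
  · intro h L _ _
    rw [restrict_mem_lowerRam_iff]
    intro x hx hx1
    have hσx : σ x ∈ L := by
      have := (AlgEquiv.restrictNormalHom L σ ⟨x, hx⟩).2
      rwa [AlgEquiv.restrictNormalHom_apply] at this
    rw [zero_add, one_mul]
    exact sepAbs_le_of_lt_one L (sub_mem hσx hx) (h x hx1)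

theorem sepAbs_inv_sub_one_lt {a : Sep K} (ha : sepAbs K (a - 1) < 1) :
    sepAbs K (a⁻¹ - 1) < 1 := by
  have ha1 : sepAbs K a = 1 := by
    have := (sepAbs K).map_one_add_of_lt ha
    rwa [add_sub_cancel] at this
  have ha0 : a ≠ 0 := by rintro rfl; simp at ha1
  have : a⁻¹ - 1 = -(a⁻¹ * (a - 1)) := by field_simp; ring
  rwa [this, Valuation.map_neg, map_mul, map_inv₀, ha1, inv_one, one_mul]

theorem sepAbs_zpow_sub_one_lt {a : Sep K} (ha : sepAbs K (a - 1) < 1) (k : ℤ) :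
    sepAbs K (a ^ k - 1) < 1 := by
  have hnat : ∀ n : ℕ, sepAbs K (a ^ n - 1) < 1 := by
    intro n
    induction n with
    | zero => simp
    | succ n ih => rw [pow_succ]; exact sepAbs_mul_sub_one_lt ih ha
  obtain ⟨n, rfl | rfl⟩ := k.eq_nat_or_neg
  · rw [zpow_natCast]; exact hnat n
  · rw [zpow_neg, zpow_natCast]; exact sepAbs_inv_sub_one_lt (hnat n)

theorem wildInertia_eq : wildInertia K = wildGroup K := by
  ext σ
  constructor
  · intro h
    have hI : σ ∈ inertiaGroup K := by
      intro x hx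
      let L := FiniteGaloisIntermediateField.adjoin K {x}
      have hxL : x ∈ L.toIntermediateField := FiniteGaloisIntermediateField.subset_adjoin K {x} rfl
      have := restrict_mem_lowerRam_iff.mp (h L.toIntermediateField) x hxL hx
      exact sepAbs_lt_one_of_le L.toIntermediateField (by norm_num) this
    intro x hx0
    let L := FiniteGaloisIntermediateField.adjoin K {x}
    have hxL : x ∈ L.toIntermediateField := FiniteGaloisIntermediateField.subset_adjoin K {x} rfl
    obtain ⟨ϖ, hϖL, hϖ⟩ := exists_uniformizer_of_finite L.toIntermediateField
    have hϖ0 : ϖ ≠ 0 := by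
      rintro rfl
      rw [map_zero] at hϖ
      exact (Real.exp_pos _).ne hϖ
    have hu := unifVal_pos L.toIntermediateField
    -- for a uniformizer the claim is the definition of the first ramification group
    have h1 : sepAbs K (σ ϖ / ϖ - 1) < 1 := by
      have hϖ1 : sepAbs K ϖ ≤ 1 := by
        have : (sepAbs K ϖ : ℝ) ≤ 1 := by rw [hϖ, Real.exp_le_one_iff]; linarith
        exact_mod_cast this
      have h2 := restrict_mem_lowerRam_iff.mp (h L.toIntermediateField) ϖ hϖL hϖ1
      have h3 : (sepAbs K (σ ϖ - ϖ) : ℝ) < sepAbs K ϖ := by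
        rw [hϖ]
        refine h2.trans_lt (Real.exp_lt_exp.mpr ?_)
        linarith
      rw [div_sub_one hϖ0, map_div₀]
      exact (div_lt_one₀ (by exact_mod_cast sepAbs_pos hϖ0)).mpr (by exact_mod_cast h3)
    obtain ⟨k, hk⟩ := exists_sepAbs_eq_zpow L.toIntermediateField hxL hx0 hϖL hϖ
    have h2 := sepAbs_div_sub_div_lt hI hx0 (zpow_ne_zero k hϖ0) hk
    have h3 := sepAbs_zpow_sub_one_lt h1 k
    have : σ x / x - 1 = (σ x / x - σ (ϖ ^ k) / ϖ ^ k) + ((σ ϖ / ϖ) ^ k - 1) := by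
      rw [map_zpow₀, div_zpow]; ring
    rw [this]
    exact Valuation.map_add_lt _ h2 h3
  · intro hσ L _ _
    have hI := wildGroup_le_inertiaGroup hσ
    rw [restrict_mem_lowerRam_iff]
    have hmemL : ∀ x ∈ L, σ x ∈ L := by
      intro x hx
      have := (AlgEquiv.restrictNormalHom L σ ⟨x, hx⟩).2
      rwa [AlgEquiv.restrictNormalHom_apply] at this
    have hlt : ∀ x ∈ L, sepAbs K x < 1 →
        (sepAbs K (σ x - x) : ℝ) ≤ Real.exp (-((1 + 1) * unifVal L)) := by
      intro x hx hx1
      rcases eq_or_ne x 0 with rfl | hx0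
      · simp [Real.exp_nonneg]
      have h1 := sepAbs_le_of_lt_one L hx hx1
      have h2 := sepAbs_le_of_lt_one L (sub_mem (div_mem (hmemL x hx) hx) (one_mem L)) (hσ x hx0)
      have h3 : σ x - x = x * (σ x / x - 1) := by field_simp
      rw [h3, map_mul, NNReal.coe_mul]
      have h4 : Real.exp (-((1 + 1) * unifVal L)) =
          Real.exp (-unifVal L) * Real.exp (-unifVal L) := by
        rw [← Real.exp_add]; congr 1; ring
      rw [h4]
      exact mul_le_mul h1 h2 (NNReal.coe_nonneg _) (Real.exp_nonneg _)
    intro x hx hx1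
    rcases hx1.lt_or_eq with hx1 | hx1
    · exact hlt x hx hx1
    -- the root of unity congruent to `x` lies in `L`, and it is fixed by `σ`
    obtain ⟨n, ζ, hn, hζ, hxζ⟩ := exists_root_of_unity_sub_lt hx1
    have hζL : ζ ∈ L := by
      rw [← InfiniteGalois.fixedField_fixingSubgroup L, mem_fixedField_iff]
      intro τ hτ
      have hτx : τ x = x := (IntermediateField.mem_fixingSubgroup_iff L τ).mp hτ x hx
      refine eq_of_pow_of_sepAbs_sub_lt hn (by rw [← map_pow, hζ, map_one]) hζ ?_
      have : τ ζ - ζ = (x - ζ) - τ (x - ζ) := by rw [map_sub, hτx]; ring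
      rw [this]
      exact Valuation.map_sub_lt _ hxζ ((sepAbs_aut τ _).trans_lt hxζ)
    have hσζ := mem_inertiaGroup_iff_fixes.mp hI n ζ hn hζ
    have : σ x - x = σ (x - ζ) - (x - ζ) := by rw [map_sub, hσζ]; ring
    rw [this]
    exact hlt (x - ζ) (sub_mem hx hζL) hxζ

/-- A continuous homomorphism to a discrete group is trivial on the ramification groups of large
index. -/
theorem exists_image_absUpperRam_eq_one {G : Type*} [Group G] [TopologicalSpace G]
    [DiscreteTopology G] (f : AbsGal K →ₜ* G) :
    ∃ T : ℝ, ∀ u, T ≤ u → ∀ σ ∈ absUpperRam K u, f σ = 1 := by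
  have hker : f ⁻¹' {1} ∈ nhds (1 : AbsGal K) :=
    ((isOpen_discrete {1}).preimage f.continuous_toFun).mem_nhds (map_one f)
  obtain ⟨L, hL⟩ := (InfiniteGalois.krullTopology_mem_nhds_one_iff_of_isGalois _).mp hker
  obtain ⟨T, hT⟩ := exists_upperRam_eq_one L.toIntermediateField
  refine ⟨T, fun u hu σ hσ => hL ?_⟩
  have h1 : AlgEquiv.restrictNormalHom L.toIntermediateField σ = 1 := hT u hu (hσ _)
  refine (IntermediateField.mem_fixingSubgroup_iff _ _).mpr fun x hx => ?_
  have h2 := congrArg (fun τ => ((τ ⟨x, hx⟩ : L.toIntermediateField) : Sep K)) h1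
  simp only [AlgEquiv.restrictNormalHom_apply, AlgEquiv.one_apply] at h2
  exact h2

end Upper

/-! ### Multiplicities in integral representations -/

section Transfer
open Polynomial

theorem pow_eq_pow_iff_of_isPrimitiveRoot {R : Type*} [CommMonoid R] {ξ : R} {n : ℕ}
    (hξ : IsPrimitiveRoot ξ n) (hn : 0 < n) {i j : ℕ} : ξ ^ i = ξ ^ j ↔ i ≡ j [MOD n] := by
  rw [hξ.eq_orderOf]
  exact (hξ.isOfFinOrder hn.ne').pow_eq_pow_iff_modEq

/-- The characteristic polynomial of a multiple of a projection. -/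
theorem charpoly_smul_isProj {F W : Type*} [Field F] [AddCommGroup W] [Module F W]
    [FiniteDimensional F W] {U : Submodule F W} {p : W →ₗ[F] W} (hp : LinearMap.IsProj U p)
    (a : F) : ∃ k : ℕ, (a • p).charpoly = X ^ k * (X - C a) ^ Module.finrank F U := by
  refine ⟨Module.finrank F (LinearMap.ker p), ?_⟩
  have hconj : a • p = (Submodule.prodEquivOfIsCompl _ _ hp.isCompl).conj
      (LinearMap.prodMap (a • LinearMap.id) (0 : LinearMap.ker p →ₗ[F] LinearMap.ker p)) := by
    have h : LinearMap.prodMap (a • LinearMap.id) (0 : LinearMap.ker p →ₗ[F] LinearMap.ker p) =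
        a • LinearMap.prodMap (LinearMap.id : U →ₗ[F] U) 0 := by
      ext <;> simp
    rw [h, map_smul, ← hp.eq_conj_prodMap]
  have h1 : (a • (LinearMap.id : U →ₗ[F] U)).charpoly = (X - C a) ^ Module.finrank F U := by
    have h : LinearMap.toMatrix (Module.finBasis F U) (Module.finBasis F U)
        (a • (LinearMap.id : U →ₗ[F] U)) = Matrix.diagonal fun _ => a := by
      rw [map_smul, LinearMap.toMatrix_id, Matrix.smul_one_eq_diagonal]
    rw [← LinearMap.charpoly_toMatrix _ (Module.finBasis F U), h, Matrix.charpoly_diagonal,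
      Finset.prod_const, Finset.card_univ, Fintype.card_fin]
  rw [hconj, LinearEquiv.charpoly_conj, LinearMap.charpoly_prodMap, h1, LinearMap.charpoly_zero,
    mul_comm]

theorem rootMultiplicity_X_pow_mul {F : Type*} [Field F] {a : F} (ha : a ≠ 0) (k r : ℕ) :
    rootMultiplicity a (X ^ k * (X - C a) ^ r) = r := by
  have h0 : (X ^ k * (X - C a) ^ r : F[X]) ≠ 0 :=
    mul_ne_zero (pow_ne_zero _ X_ne_zero) (pow_ne_zero _ (X_sub_C_ne_zero a))
  rw [rootMultiplicity_mul h0, rootMultiplicity_X_sub_C_pow, rootMultiplicity_eq_zero, zero_add]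
  simpa [IsRoot] using fun h => absurd h ha

/-- Integral relations of a complex primitive root of unity hold for primitive roots of unity of
the same order in any field. -/
theorem aeval_primitiveRoot_eq_zero {F : Type*} [Field F] {n : ℕ} (hn : 0 < n) {ω : ℂ} {ζ : F}
    (hω : IsPrimitiveRoot ω n) (hζ : IsPrimitiveRoot ζ n) {q : ℤ[X]} (hq : aeval ω q = 0) :
    aeval ζ q = 0 := by
  have hdvd : cyclotomic n ℤ ∣ q := by
    rw [cyclotomic_eq_minpoly hω hn]
    exact minpoly.isIntegrallyClosed_dvd (hω.isIntegral hn) hq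
  obtain ⟨r, rfl⟩ := hdvd
  have : aeval ζ (cyclotomic n ℤ) = 0 := by
    rw [aeval_def, ← eval_map, algebraMap_int_eq, map_cyclotomic_int]
    exact hζ.isRoot_cyclotomic hn
  rw [map_mul, this, zero_mul]

theorem map_aeval_primitiveRoot_eq {F : Type*} [Field F] {n : ℕ} (hn : 0 < n) {ω : ℂ} {ζ : F}
    (hω : IsPrimitiveRoot ω n) (hζ : IsPrimitiveRoot ζ n) {P Q : ℤ[X][X]}
    (h : P.map (aeval ω : ℤ[X] →ₐ[ℤ] ℂ).toRingHom = Q.map (aeval ω : ℤ[X] →ₐ[ℤ] ℂ).toRingHom) :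
    P.map (aeval ζ : ℤ[X] →ₐ[ℤ] F).toRingHom = Q.map (aeval ζ : ℤ[X] →ₐ[ℤ] F).toRingHom := by
  ext i
  have hi := congrArg (fun p => p.coeff i) h
  simp only [coeff_map] at hi ⊢
  rw [← sub_eq_zero, ← map_sub] at hi ⊢
  exact aeval_primitiveRoot_eq_zero hn hω hζ hi

/-- Averaging against the inverse of a one-dimensional character projects onto the eigenspace. -/
theorem isProj_eigenspaceOf {F G W : Type*} [Field F] [Group G] [AddCommGroup W] [Module F W]
    (H : Subgroup G) [Fintype H] (hH : (Fintype.card H : F) ≠ 0) (ρ : Representation F G W)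
    (χ : G → F) (h1 : χ 1 = 1) (hχ : ∀ a ∈ H, ∀ b ∈ H, χ (a * b) = χ a * χ b) :
    LinearMap.IsProj (eigenspaceOf (H : Set G) ρ χ)
      ((Fintype.card H : F)⁻¹ • ∑ h : H, χ (h : G)⁻¹ • ρ h) := by
  have hinv : ∀ a ∈ H, χ a⁻¹ * χ a = 1 := fun a ha => by
    rw [← hχ _ (H.inv_mem ha) _ ha, inv_mul_cancel, h1]
  constructor
  · intro w a ha
    simp only [LinearMap.smul_apply, LinearMap.sum_apply, map_smul, map_sum]
    rw [smul_comm]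
    congr 1
    rw [Finset.smul_sum]
    have ha' : a ∈ H := ha
    refine Fintype.sum_equiv (Equiv.mulLeft (⟨a, ha'⟩ : H)) _ _ ?_
    intro h
    have e : ρ (a * (h : G)) w = ρ a (ρ (h : G) w) := by rw [map_mul]; rfl
    simp only [Equiv.coe_mulLeft, Subgroup.coe_mul, e, smul_smul]
    congr 1
    rw [mul_inv_rev, hχ _ (H.inv_mem h.2) _ (H.inv_mem ha'), mul_left_comm, mul_comm (χ a),
      hinv a ha', mul_one]
  · intro w hw
    have : ∀ h : H, χ (h : G)⁻¹ • ρ (h : G) w = w := fun h => by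
      rw [hw h h.2, smul_smul, hinv _ h.2, one_smul]
    simp only [LinearMap.smul_apply, LinearMap.sum_apply, this, Finset.sum_const,
      Finset.card_univ]
    rw [← Nat.cast_smul_eq_nsmul F, smul_smul, inv_mul_cancel₀ hH, one_smul]

/-- The matrix `∑ X ^ c(h⁻¹) M(h)` over `ℤ[X]`, which specializes to a multiple of the projection
onto an eigenspace. -/
noncomputable def eigenMatrix {G : Type*} [Group G] {N : ℕ} (M : G → Matrix (Fin N) (Fin N) ℤ)
    (H : Subgroup G) [Fintype H] (c : G → ℕ) : Matrix (Fin N) (Fin N) ℤ[X] :=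
  ∑ h : H, (X ^ c (h : G)⁻¹ : ℤ[X]) • (M h).map C

theorem charpoly_eigenMatrix {F G W : Type*} [Field F] [Group G] [AddCommGroup W] [Module F W]
    [FiniteDimensional F W] {N : ℕ} (M : G → Matrix (Fin N) (Fin N) ℤ) (ρ : Representation F G W)
    (b : Module.Basis (Fin N) F W)
    (hM : ∀ g, LinearMap.toMatrix b b (ρ g) = (M g).map (Int.cast : ℤ → F))
    (H : Subgroup G) [Fintype H] (hH : (Fintype.card H : F) ≠ 0) (c : G → ℕ) (ζ : F)
    (h1 : ζ ^ c 1 = 1) (hc : ∀ a ∈ H, ∀ b ∈ H, ζ ^ c (a * b) = ζ ^ c a * ζ ^ c b) :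
    ∃ k : ℕ, (eigenMatrix M H c).charpoly.map (aeval ζ : ℤ[X] →ₐ[ℤ] F).toRingHom =
      X ^ k * (X - C (Fintype.card H : F)) ^ mult (H : Set G) ρ (fun g => ζ ^ c g) := by
  obtain ⟨k, hk⟩ := charpoly_smul_isProj (isProj_eigenspaceOf H hH ρ (fun g => ζ ^ c g) h1 hc)
    (Fintype.card H : F)
  refine ⟨k, ?_⟩
  rw [mult, ← hk, smul_smul, mul_inv_cancel₀ hH, one_smul, ← Matrix.charpoly_map,
    ← LinearMap.charpoly_toMatrix _ b]
  congr 1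
  rw [map_sum]
  simp only [map_smul, hM]
  ext i j
  simp [eigenMatrix, Matrix.sum_apply]

theorem exponent_one_modEq {G : Type*} [Group G] {D : Subgroup G} {n : ℕ} {c : G → ℕ}
    (hc : ∀ a ∈ D, ∀ b ∈ D, c (a * b) ≡ c a + c b [MOD n]) :
    c 1 ≡ 0 [MOD n] := by
  have := hc 1 D.one_mem 1 D.one_mem
  rw [mul_one] at this
  exact (Nat.ModEq.add_left_cancel' (c 1) (by rwa [add_zero])).symm

/-- The multiplicity of a character of order dividing `n` in an integral representation is the same
over `ℂ` as over any field in which the order of the group is invertible. -/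
theorem mult_eq_of_isPrimitiveRoot {F G W W' : Type*} [Field F] [Group G] [AddCommGroup W]
    [Module F W] [FiniteDimensional F W] [AddCommGroup W'] [Module ℂ W'] [FiniteDimensional ℂ W']
    {N : ℕ} (M : G → Matrix (Fin N) (Fin N) ℤ) (ρ : Representation F G W)
    (b : Module.Basis (Fin N) F W)
    (hM : ∀ g, LinearMap.toMatrix b b (ρ g) = (M g).map (Int.cast : ℤ → F))
    (ρ' : Representation ℂ G W') (b' : Module.Basis (Fin N) ℂ W')
    (hM' : ∀ g, LinearMap.toMatrix b' b' (ρ' g) = (M g).map (Int.cast : ℤ → ℂ))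
    (H : Subgroup G) [Fintype H] (hH : (Fintype.card H : F) ≠ 0) {n : ℕ} (hn : 0 < n)
    (c : G → ℕ) (hc : ∀ a ∈ H, ∀ b ∈ H, c (a * b) ≡ c a + c b [MOD n])
    {ω : ℂ} {ζ : F} (hω : IsPrimitiveRoot ω n) (hζ : IsPrimitiveRoot ζ n) :
    mult (H : Set G) ρ (fun g => ζ ^ c g) = mult (H : Set G) ρ' (fun g => ω ^ c g) := by
  have hc1 := exponent_one_modEq hc
  have hH' : (Fintype.card H : ℂ) ≠ 0 := Nat.cast_ne_zero.mpr Fintype.card_ne_zero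
  obtain ⟨k, hk⟩ := charpoly_eigenMatrix M ρ b hM H hH c ζ
    (by rw [(pow_eq_pow_iff_of_isPrimitiveRoot hζ hn).mpr hc1, pow_zero]) fun x hx y hy => by
      rw [← pow_add, (pow_eq_pow_iff_of_isPrimitiveRoot hζ hn).mpr (hc x hx y hy)]
  obtain ⟨k', hk'⟩ := charpoly_eigenMatrix M ρ' b' hM' H hH' c ω
    (by rw [(pow_eq_pow_iff_of_isPrimitiveRoot hω hn).mpr hc1, pow_zero]) fun x hx y hy => by
      rw [← pow_add, (pow_eq_pow_iff_of_isPrimitiveRoot hω hn).mpr (hc x hx y hy)]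
  have htrans := map_aeval_primitiveRoot_eq hn hω hζ (P := (eigenMatrix M H c).charpoly)
    (Q := X ^ k' * (X - C (Fintype.card H : ℤ[X])) ^ mult (H : Set G) ρ' (fun g => ω ^ c g)) (by
      rw [hk']; simp)
  rw [hk] at htrans
  have h := congrArg (rootMultiplicity (Fintype.card H : F)) htrans
  rw [rootMultiplicity_X_pow_mul hH] at h
  rw [h]
  have : ((X ^ k' * (X - C (Fintype.card H : ℤ[X])) ^ mult (H : Set G) ρ' (fun g => ω ^ c g)).map
      (aeval ζ : ℤ[X] →ₐ[ℤ] F).toRingHom) =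
      X ^ k' * (X - C (Fintype.card H : F)) ^ mult (H : Set G) ρ' (fun g => ω ^ c g) := by
    simp
  rw [this, rootMultiplicity_X_pow_mul hH]

end Transfer

/-! ### Invariants of the kernel of a character -/

section Sum
open Finset

theorem mult_congr {F G W : Type*} [Field F] [Group G] [AddCommGroup W] [Module F W] {H : Set G}
    (ρ : Representation F G W) {χ χ' : G → F} (h : ∀ g ∈ H, χ g = χ' g) :
    mult H ρ χ = mult H ρ χ' := by
  have : eigenspaceOf H ρ χ = eigenspaceOf H ρ χ' := by
    ext w
    constructor
    · intro hw g hg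
      rw [← h g hg]; exact hw g hg
    · intro hw g hg
      rw [h g hg]; exact hw g hg
  rw [mult, mult, this]

theorem geom_sum_primitiveRoot {n : ℕ} (hn : 0 < n) {ω : ℂ} (hω : IsPrimitiveRoot ω n) (a : ℕ) :
    ∑ j ∈ range n, ω ^ (j * a) = if a ≡ 0 [MOD n] then (n : ℂ) else 0 := by
  have h1 : ω ^ a = 1 ↔ a ≡ 0 [MOD n] := by
    rw [← pow_eq_pow_iff_of_isPrimitiveRoot hω hn, pow_zero]
  have h2 : ∀ j, ω ^ (j * a) = (ω ^ a) ^ j := fun j => by rw [← pow_mul, mul_comm]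
  simp only [h2]
  split_ifs with h
  · simp [h1.mpr h]
  · have hne : ω ^ a ≠ 1 := fun h' => h (h1.mp h')
    rw [geom_sum_eq hne, ← pow_mul, mul_comm, pow_mul, hω.pow_eq_one, one_pow, sub_self, zero_div]

section
variable {G : Type*} [Group G] {D P : Subgroup G} {n : ℕ} {c : G → ℕ}

/-- The invariants of the kernel `P` of a character of order `n` decompose into the eigenspaces of
the powers of this character. -/
theorem mult_one_eq_sum_mult_pow [Finite G] (hPD : P ≤ D) (hn : 0 < n)
    (hc : ∀ a ∈ D, ∀ b ∈ D, c (a * b) ≡ c a + c b [MOD n])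
    (hcP : ∀ g ∈ D, c g ≡ 0 [MOD n] ↔ g ∈ P) (hcard : Nat.card D = n * Nat.card P)
    {W : Type*} [AddCommGroup W] [Module ℂ W] [FiniteDimensional ℂ W]
    (ρ : Representation ℂ G W) {ω : ℂ} (hω : IsPrimitiveRoot ω n) :
    mult (P : Set G) ρ 1 = ∑ j ∈ range n, mult (D : Set G) ρ (fun g => ω ^ (j * c g)) := by
  classical
  have := Fintype.ofFinite G
  have hDP : ((Fintype.card D : ℕ) : ℂ)⁻¹ * n = ((Fintype.card P : ℕ) : ℂ)⁻¹ := by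
    rw [← Nat.card_eq_fintype_card, hcard, Nat.card_eq_fintype_card]
    have h1 : (n : ℂ) ≠ 0 := Nat.cast_ne_zero.mpr hn.ne'
    push_cast
    field_simp
  have hpow : ∀ {i j : ℕ}, i ≡ j [MOD n] → ω ^ i = ω ^ j := fun h =>
    (pow_eq_pow_iff_of_isPrimitiveRoot hω hn).mpr h
  refine Nat.cast_injective (R := ℂ) ?_
  rw [Nat.cast_sum, mult_eq_average P (Nat.cast_ne_zero.mpr Fintype.card_ne_zero) ρ 1 rfl
    fun _ _ _ _ => (mul_one _).symm]
  have h1 : ∀ j ∈ range n, (mult (D : Set G) ρ (fun g => ω ^ (j * c g)) : ℂ) =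
      (Fintype.card D : ℂ)⁻¹ * ∑ h : D, LinearMap.trace ℂ W (ρ h) * ω ^ (j * c (h : G)⁻¹) := by
    intro j _
    refine mult_eq_average D (Nat.cast_ne_zero.mpr Fintype.card_ne_zero) ρ _ ?_ ?_
    · rw [hpow ((exponent_one_modEq hc).mul_left j), mul_zero, pow_zero]
    · intro a ha b hb
      rw [← pow_add, ← mul_add]
      exact hpow ((hc a ha b hb).mul_left j)
  rw [sum_congr rfl h1, ← mul_sum, sum_comm]
  simp only [← mul_sum, geom_sum_primitiveRoot hn hω]
  have h2 : ∀ h : D, LinearMap.trace ℂ W (ρ h) * (if c (h : G)⁻¹ ≡ 0 [MOD n] then (n : ℂ) else 0) =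
      n * if (h : G) ∈ P then LinearMap.trace ℂ W (ρ h) else 0 := by
    intro h
    have : c (h : G)⁻¹ ≡ 0 [MOD n] ↔ (h : G) ∈ P := by
      rw [hcP _ (D.inv_mem h.2), inv_mem_iff]
    simp only [this]
    split_ifs <;> ring
  simp only [h2]
  rw [← mul_sum, ← mul_assoc, hDP]
  congr 1
  rw [← sum_filter]
  simp only [Pi.one_apply, mul_one]
  refine sum_bij' (fun h _ => ⟨h, hPD h.2⟩)
    (fun h hh => ⟨h, (mem_filter.mp hh).2⟩) ?_ ?_ ?_ ?_ ?_
  · intro h _; exact mem_filter.mpr ⟨mem_univ _, h.2⟩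
  · intro h _; exact mem_univ _
  · intro h _; rfl
  · intro h _; rfl
  · intro h _; rfl

end

section
variable {F G W W' : Type*} [Field F] [Group G] [Finite G] [AddCommGroup W]
    [Module F W] [FiniteDimensional F W] [AddCommGroup W'] [Module ℂ W'] [FiniteDimensional ℂ W']
    {N : ℕ} {M : G → Matrix (Fin N) (Fin N) ℤ} {ρ : Representation F G W}
    {b : Module.Basis (Fin N) F W} {ρ' : Representation ℂ G W'} {b' : Module.Basis (Fin N) ℂ W'}

/-- The dimension of the invariants is the same over `ℂ` as over any field in which the order of
the group is invertible. -/
theorem mult_one_eq (hM : ∀ g, LinearMap.toMatrix b b (ρ g) = (M g).map (Int.cast : ℤ → F))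
    (hM' : ∀ g, LinearMap.toMatrix b' b' (ρ' g) = (M g).map (Int.cast : ℤ → ℂ))
    (hG : ((Nat.card G : ℕ) : F) ≠ 0) (H : Subgroup G) :
    mult (H : Set G) ρ 1 = mult (H : Set G) ρ' 1 := by
  classical
  have := Fintype.ofFinite G
  have hH : ((Fintype.card H : ℕ) : F) ≠ 0 := by
    obtain ⟨k, hk⟩ := H.card_subgroup_dvd_card
    rw [hk, Nat.cast_mul, Nat.card_eq_fintype_card] at hG
    exact left_ne_zero_of_mul hG
  have h := mult_eq_of_isPrimitiveRoot M ρ b hM ρ' b' hM' H hH one_pos (fun _ => 0)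
    (fun _ _ _ _ => rfl) (IsPrimitiveRoot.one (M := ℂ)) (IsPrimitiveRoot.one (M := F))
  simp only [pow_zero] at h
  exact h

/-- The invariants of the kernel of a character of order `n` of `D` in an integral representation:
by rationality, the multiplicity of a power of the character depends only on its order. -/
theorem mult_one_eq_add_sum_properDivisors
    (hM : ∀ g, LinearMap.toMatrix b b (ρ g) = (M g).map (Int.cast : ℤ → F))
    (hM' : ∀ g, LinearMap.toMatrix b' b' (ρ' g) = (M g).map (Int.cast : ℤ → ℂ))
    (hG : ((Nat.card G : ℕ) : F) ≠ 0) {D P : Subgroup G} {n : ℕ} {c : G → ℕ}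
    (hPD : P ≤ D) (hn : 0 < n)
    (hc : ∀ a ∈ D, ∀ b ∈ D, c (a * b) ≡ c a + c b [MOD n])
    (hcP : ∀ g ∈ D, c g ≡ 0 [MOD n] ↔ g ∈ P) (hcard : Nat.card D = n * Nat.card P)
    {ζ : F} (hζ : IsPrimitiveRoot ζ n) :
    mult (P : Set G) ρ 1 = (∑ d ∈ n.properDivisors,
      Nat.totient (n / d) * mult (D : Set G) ρ (fun g => (ζ ^ c g) ^ d)) +
        mult (D : Set G) ρ 1 := by
  classical
  have := Fintype.ofFinite G
  have hD : ((Fintype.card D : ℕ) : F) ≠ 0 := by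
    obtain ⟨k, hk⟩ := D.card_subgroup_dvd_card
    rw [hk, Nat.cast_mul, Nat.card_eq_fintype_card] at hG
    exact left_ne_zero_of_mul hG
  have hω := Complex.isPrimitiveRoot_exp n hn.ne'
  set ω := Complex.exp (2 * Real.pi * Complex.I / n)
  rw [mult_one_eq hM hM' hG P, mult_one_eq_sum_mult_pow hPD hn hc hcP hcard ρ' hω]
  -- the `j` with `gcd(n, j) = d` belong to the characters of order `n / d`
  have hfib : ∀ d ∈ n.divisors, ∀ j ∈ (range n).filter (fun j => n.gcd j = d),
      mult (D : Set G) ρ' (fun g => ω ^ (j * c g)) =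
        mult (D : Set G) ρ (fun g => (ζ ^ c g) ^ d) := by
    intro d hd j hj
    have hdn : d ∣ n := Nat.dvd_of_mem_divisors hd
    have hgcd : n.gcd j = d := (mem_filter.mp hj).2
    have hnd : 0 < n / d := Nat.div_pos (Nat.le_of_dvd hn hdn) (Nat.pos_of_dvd_of_pos hdn hn)
    have h1 : IsPrimitiveRoot (ω ^ j) (n / d) := by
      rw [IsPrimitiveRoot.iff_orderOf, (hω.isOfFinOrder hn.ne').orderOf_pow, ← hω.eq_orderOf, hgcd]
    have h2 : IsPrimitiveRoot (ζ ^ d) (n / d) :=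
      hζ.pow hn (Nat.mul_div_cancel' hdn).symm
    have h := mult_eq_of_isPrimitiveRoot M ρ b hM ρ' b' hM' D hD hnd c
      (fun x hx y hy => (hc x hx y hy).of_dvd (Nat.div_dvd_of_dvd hdn)) h1 h2
    simp only [← pow_mul] at h ⊢
    rw [← h]
    congr 1
    funext g
    rw [mul_comm]
  rw [← sum_fiberwise_of_maps_to (s := range n) (t := n.divisors) (g := fun j => n.gcd j)
    fun j _ => Nat.mem_divisors.mpr ⟨Nat.gcd_dvd_left n j, hn.ne'⟩]
  rw [sum_congr rfl fun d hd => sum_congr rfl (hfib d hd)]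
  simp only [sum_const, smul_eq_mul]
  rw [sum_congr rfl fun d hd => by
    rw [← Nat.totient_div_of_dvd (Nat.dvd_of_mem_divisors hd)],
    ← Nat.insert_self_properDivisors hn.ne', sum_insert Nat.self_notMem_properDivisors,
    Nat.div_self hn, Nat.totient_one, one_mul, add_comm]
  congr 2
  funext g
  rw [← pow_mul, mul_comm, pow_mul, hζ.pow_eq_one, one_pow, Pi.one_apply]

theorem innerProd_one_eq_mult {V : Type*} [AddCommGroup V] [Module ℚ V] [FiniteDimensional ℚ V]
    (ρ : Representation ℚ G V) (H : Subgroup G) :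
    innerProd (H : Set G) (fun g => ((ρ.character g : ℚ) : ℂ)) 1 =
      mult (H : Set G) (extendScalars ℂ ρ) 1 := by
  classical
  have := Fintype.ofFinite G
  rw [mult_eq_average H (Nat.cast_ne_zero.mpr Fintype.card_ne_zero) (extendScalars ℂ ρ) 1 rfl
    fun _ _ _ _ => (mul_one _).symm, innerProd]
  congr 2
  · rw [← Nat.card_eq_fintype_card]; rfl
  · rw [← finsum_set_coe_eq_finsum_mem (H : Set G), finsum_eq_sum_of_fintype]
    refine sum_congr rfl fun h _ => ?_
    have : extendScalars ℂ ρ h = (ρ h).baseChange ℂ := rfl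
    rw [this, LinearMap.trace_baseChange]
    simp [Representation.character]

end

end Sum

/-! ### The image of tame inertia -/

section TameImage
variable {K : Type*} [Field K] [ValuativeRel K] [TopologicalSpace K] [IsNonarchimedeanLocalField K]
variable {G : Type*} [Group G] [TopologicalSpace G]

theorem ramGroup_of_lt_one {t : ℝ} (ht : t < 1) : ramGroup K t = inertiaGroup K := by
  rw [ramGroup, if_pos ht, inertia_eq]

theorem ramGroup_one : ramGroup K 1 = wildGroup K := by
  rw [ramGroup, if_neg (lt_irrefl 1), if_pos rfl, wildInertia_eq]

theorem ramGroup_of_one_lt {t : ℝ} (ht : 1 < t) : ramGroup K t = absUpperRam K (t - 1) := by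
  rw [ramGroup, if_neg ht.not_gt, if_neg ht.ne']

/-- The image of the inertia group. -/
noncomputable def inertiaImage (f : AbsGal K →ₜ* G) : Subgroup G :=
  (inertiaGroup K).map (f : AbsGal K →* G)

/-- The image of the wild inertia group. -/
noncomputable def wildImage (f : AbsGal K →ₜ* G) : Subgroup G :=
  (wildGroup K).map (f : AbsGal K →* G)

variable (f : AbsGal K →ₜ* G)

theorem image_ramGroup_of_lt_one {t : ℝ} (ht : t < 1) : f '' ramGroup K t = inertiaImage f := by
  rw [ramGroup_of_lt_one ht]; rfl

theorem image_ramGroup_one : f '' ramGroup K 1 = wildImage f := by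
  rw [ramGroup_one]; rfl

theorem wildImage_le_inertiaImage : wildImage f ≤ inertiaImage f :=
  Subgroup.map_mono wildGroup_le_inertiaGroup

theorem card_inertiaImage : Nat.card (inertiaImage f) = e₀ f * Nat.card (wildImage f) := by
  have h : e₀ f = Nat.card (inertiaImage f) / Nat.card (wildImage f) := by
    rw [e₀, image_ramGroup_of_lt_one f one_pos, image_ramGroup_one]; rfl
  rw [h, Nat.div_mul_cancel (Subgroup.card_dvd_of_le (wildImage_le_inertiaImage f))]

variable [Finite G]

theorem e₀_pos : 0 < e₀ f := by
  have h := card_inertiaImage f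
  have h1 : Nat.card (inertiaImage f) ≠ 0 := Nat.card_pos.ne'
  rw [h] at h1
  exact Nat.pos_of_ne_zero (left_ne_zero_of_mul h1)

variable [DiscreteTopology G]

/-- The tame ramification index of `f` is prime to the residue characteristic, and the preimage of
the image of the wild inertia group is the kernel of the tame character of this order. -/
theorem exists_mem_wildImage_iff : ∃ hn : sepAbs K (e₀ f : Sep K) = 1, ∀ σ : inertiaGroup K,
    f (σ : AbsGal K) ∈ wildImage f ↔ tameChar hn σ = 1 := by
  obtain ⟨m, hm, hker⟩ := exists_tameChar_ker_subset
    (U := f ⁻¹' (wildImage f : Set G)) ((isOpen_discrete _).preimage f.continuous_toFun)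
    fun σ hσ => ⟨σ, hσ, rfl⟩
  let N : Subgroup (inertiaGroup K) :=
    ((wildImage f).comap (f : AbsGal K →* G)).subgroupOf (inertiaGroup K)
  have hN : ∀ σ : inertiaGroup K, σ ∈ N ↔ f (σ : AbsGal K) ∈ wildImage f := fun σ => Iff.rfl
  have hidx : N.index = e₀ f := by
    have h1 : N.index = (wildImage f).relIndex (inertiaImage f) :=
      Subgroup.relIndex_comap _ (f : AbsGal K →* G) (inertiaGroup K)
    have h2 := Subgroup.relIndex_mul_relIndex ⊥ _ _ bot_le (wildImage_le_inertiaImage f)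
    rw [Subgroup.relIndex_bot_left, Subgroup.relIndex_bot_left, card_inertiaImage, mul_comm] at h2
    rw [h1]
    exact Nat.eq_of_mul_eq_mul_right Nat.card_pos h2
  obtain ⟨b, hb, hNb⟩ := mem_iff_pow_eq_one_of_ker_le (ne_zero_of_sepAbs hm) (tameChar hm)
    (tameChar_pow hm) (exists_tameChar_isPrimitiveRoot hm) N fun σ hσ => hker σ hσ
  rw [hidx] at hb
  subst hb
  refine ⟨sepAbs_natCast_of_mul hm, fun σ => ?_⟩
  rw [← hN, hNb, tameChar_mul_pow hm (sepAbs_natCast_of_mul hm)]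

theorem gammaN_eq {n : ℕ} (hn : sepAbs K (n : Sep K) = 1) (σ : inertiaGroup K) :
    gammaN n (σ : AbsGal K) = tameChar hn σ := by
  have hn0 := ne_zero_of_sepAbs hn
  obtain ⟨y, hy⟩ := exists_tameRoot hn
  have hy0 := tameRoot_ne_zero hn0 hy
  have hex : ∃ ζ : Sep K, ζ ^ n = 1 ∧ ∃ x : Sep K, sepVal K x = ((1 / (n : ℝ) : ℝ) : WithTop ℝ) ∧
      0 < sepVal K ((σ : AbsGal K) x / x - ζ) :=
    ⟨_, aut_div_pow_eq_one σ hn0 hy, y, sepVal_eq_iff.mpr (sepAbs_tameRoot hn0 hy), by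
      rw [sub_self, zero_lt_sepVal_iff, map_zero]; exact one_pos⟩
  obtain ⟨h1, x, hx, h2⟩ := Classical.epsilon_spec hex
  rw [sepVal_eq_iff] at hx
  rw [zero_lt_sepVal_iff] at h2
  have hx0 : x ≠ 0 := by
    rintro rfl
    rw [map_zero] at hx
    exact (Real.exp_pos _).ne hx
  rw [tameChar_eq hn σ hy]
  refine eq_of_pow_of_sepAbs_sub_lt hn h1 (aut_div_pow_eq_one σ hn0 hy) ?_
  have h3 := sepAbs_div_sub_div_lt σ.2 hx0 hy0 (by ext; rw [hx, sepAbs_tameRoot hn0 hy])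
  have : gammaN n (σ : AbsGal K) - (σ : AbsGal K) y / y =
      ((σ : AbsGal K) x / x - (σ : AbsGal K) y / y) -
        ((σ : AbsGal K) x / x - gammaN n (σ : AbsGal K)) := by ring
  exact this ▸ Valuation.map_sub_lt _ h3 h2

/-- The character `γ_f` of the image of inertia is faithful modulo the image of wild inertia; it is
given by exponents of a primitive root of unity. -/
theorem exists_gammaF_eq_pow : ∃ (ζ : Sep K) (c : G → ℕ), IsPrimitiveRoot ζ (e₀ f) ∧
    (∀ g ∈ inertiaImage f, gammaF f g = ζ ^ c g) ∧
    (∀ a ∈ inertiaImage f, ∀ b ∈ inertiaImage f, c (a * b) ≡ c a + c b [MOD e₀ f]) ∧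
    ∀ g ∈ inertiaImage f, c g ≡ 0 [MOD e₀ f] ↔ g ∈ wildImage f := by
  obtain ⟨hn, hiff⟩ := exists_mem_wildImage_iff f
  have : NeZero (e₀ f) := ⟨(e₀_pos f).ne'⟩
  have hγ : ∀ σ : inertiaGroup K, gammaF f (f (σ : AbsGal K)) = tameChar hn σ := by
    intro σ
    have hex : ∃ τ : AbsGal K, τ ∈ inertia K ∧ f τ = f σ := ⟨σ, by rw [inertia_eq]; exact σ.2, rfl⟩
    obtain ⟨h1, h2⟩ := Classical.epsilon_spec hex
    have h1' := (Set.ext_iff.mp inertia_eq _).mp h1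
    have h3 := gammaN_eq hn ⟨_, h1'⟩
    refine h3.trans ?_
    rw [Units.val_inj, ← inv_mul_eq_one, ← map_inv, ← map_mul, ← hiff]
    have : f (((⟨_, h1'⟩ : inertiaGroup K)⁻¹ * σ : inertiaGroup K) : AbsGal K) = 1 := by
      rw [Subgroup.coe_mul, Subgroup.coe_inv, map_mul, map_inv, h2, inv_mul_cancel]
    rw [this]
    exact one_mem _
  obtain ⟨σ₀, hσ₀⟩ := exists_tameChar_isPrimitiveRoot hn
  have hζ : IsPrimitiveRoot (tameChar hn σ₀ : Sep K) (e₀ f) := IsPrimitiveRoot.coe_units_iff.mpr hσ₀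
  have hex : ∀ g : G, ∃ k : ℕ, g ∈ inertiaImage f → gammaF f g = (tameChar hn σ₀ : Sep K) ^ k := by
    intro g
    by_cases hg : g ∈ inertiaImage f
    · obtain ⟨σ, hσ, rfl⟩ := hg
      obtain ⟨i, -, hi⟩ := hζ.eq_pow_of_pow_eq_one (ξ := (tameChar hn ⟨σ, hσ⟩ : Sep K)) (by
        rw [← Units.val_pow_eq_pow_val, tameChar_pow, Units.val_one])
      exact ⟨i, fun _ => (hγ ⟨σ, hσ⟩).trans hi.symm⟩
    · exact ⟨0, fun h => absurd h hg⟩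
  choose c hc using hex
  have hpow : ∀ {i j : ℕ}, (tameChar hn σ₀ : Sep K) ^ i = (tameChar hn σ₀ : Sep K) ^ j ↔
      i ≡ j [MOD e₀ f] := pow_eq_pow_iff_of_isPrimitiveRoot hζ (e₀_pos f)
  refine ⟨_, c, hζ, fun g hg => hc g hg, ?_, ?_⟩
  · intro a ha b hb
    rw [← hpow, pow_add, ← hc _ ha, ← hc _ hb, ← hc _ (mul_mem ha hb)]
    obtain ⟨σ, hσ, rfl⟩ := ha
    obtain ⟨τ, hτ, rfl⟩ := hb
    have h1 := hγ ⟨σ, hσ⟩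
    have h2 := hγ ⟨τ, hτ⟩
    have h3 := hγ (⟨σ, hσ⟩ * ⟨τ, hτ⟩)
    rw [map_mul (tameChar hn), Units.val_mul, ← h1, ← h2, Subgroup.coe_mul, map_mul] at h3
    exact h3
  · intro g hg
    rw [← hpow, pow_zero, ← hc g hg]
    obtain ⟨σ, hσ, rfl⟩ := hg
    have h1 := hγ ⟨σ, hσ⟩
    have h2 := hiff ⟨σ, hσ⟩
    rw [← Units.val_inj, Units.val_one, ← h1] at h2
    exact h2.symm

end TameImage

/-! ### Comparison of the conductors -/

section Conductors

theorem toMatrix_extendScalars {F E G W : Type*} [Field F] [Field E] [Algebra F E] [Group G]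
    [AddCommGroup W] [Module F W] {n : ℕ} (ρ : Representation F G W) (b : Module.Basis (Fin n) F W)
    {M : G → Matrix (Fin n) (Fin n) ℤ}
    (hM : ∀ g, LinearMap.toMatrix b b (ρ g) = (M g).map (Int.cast : ℤ → F)) (g : G) :
    LinearMap.toMatrix (Algebra.TensorProduct.basis E b) (Algebra.TensorProduct.basis E b)
      (extendScalars E ρ g) = (M g).map (Int.cast : ℤ → E) := by
  have : extendScalars E ρ g = (ρ g).baseChange E := rfl
  rw [this, LinearMap.toMatrix_baseChange, hM]
  ext i j
  simp

theorem mult_one_le_of_subset {F G W : Type*} [Field F] [Group G] [AddCommGroup W] [Module F W]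
    [FiniteDimensional F W] (ρ : Representation F G W) {H H' : Set G} (h : H ⊆ H') :
    mult H' ρ 1 ≤ mult H ρ 1 :=
  Submodule.finrank_mono fun _ hw g hg => hw g (h hg)

theorem mult_one_eq_finrank {F G W : Type*} [Field F] [Group G] [AddCommGroup W] [Module F W]
    (ρ : Representation F G W) {H : Set G} (h : ∀ g ∈ H, g = 1) :
    mult H ρ 1 = Module.finrank F W := by
  have : eigenspaceOf H ρ 1 = ⊤ := by
    refine eq_top_iff.mpr fun w _ g hg => ?_
    rw [h g hg, map_one, Pi.one_apply, one_smul]; rfl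
  rw [mult, this, finrank_top]

theorem Corresponds.character_one {G K V W : Type*} [Group G] [Field K] [AddCommGroup V]
    [Module ℚ V] [AddCommGroup W] [Module K W] {ρ : Representation ℚ G V}
    {τ : Representation K G W} (hτ : Corresponds ρ τ) :
    ((ρ.character 1 : ℚ) : ℂ) = (Module.finrank K W : ℂ) := by
  obtain ⟨n, b, c, M, hM⟩ := hτ
  have : FiniteDimensional ℚ V := b.finiteDimensional_of_finite
  rw [Representation.char_one, Module.finrank_eq_card_basis b, Module.finrank_eq_card_basis c]
  simp

/-- The invariants of a subgroup have the same dimension in both representations. -/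
theorem innerProd_one_eq_mult_of_corresponds {G K V W : Type*} [Group G] [Finite G] [Field K]
    [AddCommGroup V] [Module ℚ V] [FiniteDimensional ℚ V] [AddCommGroup W] [Module K W]
    [FiniteDimensional K W] {ρ : Representation ℚ G V} {τ : Representation K G W}
    (E : Type*) [Field E] [Algebra K E] (hG : ((Nat.card G : ℕ) : K) ≠ 0)
    (hτ : Corresponds ρ τ) (H : Subgroup G) :
    innerProd (H : Set G) (fun g => ((ρ.character g : ℚ) : ℂ)) 1 =
      (mult (H : Set G) (extendScalars E τ) 1 : ℂ) := by
  obtain ⟨n, b, c, M, hM⟩ := hτ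
  have hG' : ((Nat.card G : ℕ) : E) ≠ 0 := by
    rw [← map_natCast (algebraMap K E)]
    exact (map_ne_zero _).mpr hG
  rw [innerProd_one_eq_mult, mult_one_eq (toMatrix_extendScalars (E := E) τ c fun g => (hM g).2)
    (toMatrix_extendScalars (E := ℂ) ρ b fun g => (hM g).1) hG' H]

variable {K : Type*} [Field K] [ValuativeRel K] [TopologicalSpace K] [IsNonarchimedeanLocalField K]
variable {G : Type*} [Group G] [TopologicalSpace G]
variable {W : Type*} [AddCommGroup W] [Module K W] [FiniteDimensional K W]

theorem ramGroupBar_of_le_one {t : ℝ} (ht : t ≤ 1) : ramGroupBar K t = ramGroup K 1 := by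
  rw [ramGroupBar, max_eq_right ht]

theorem ramGroupBar_of_one_le {t : ℝ} (ht : 1 ≤ t) : ramGroupBar K t = ramGroup K t := by
  rw [ramGroupBar, max_eq_left ht]

/-- The integrand of the fine conductor is monotone on `(1, ∞)`, where it depends on the higher
ramification groups only, and it vanishes eventually; so it is integrable there. -/
theorem integrableOn_fineIntegrand_Ioi_one [DiscreteTopology G] (f : AbsGal K →ₜ* G)
    (τ : Representation K G W) : IntegrableOn (fineIntegrand f τ) (Set.Ioi 1) := by
  obtain ⟨T, hT⟩ := exists_image_absUpperRam_eq_one f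
  let g : ℝ → ℝ := fun t => (Module.finrank K W : ℝ) -
    (mult (f '' absUpperRam K (t - 1)) (extendScalars (Sep K) τ) 1 : ℝ)
  have hg : Set.EqOn g (fineIntegrand f τ) (Set.Ioi 1) := fun t ht => by
    rw [fineIntegrand, ramGroupBar_of_one_le (le_of_lt ht), ramGroup_of_one_lt ht]
  refine IntegrableOn.congr_fun ?_ hg measurableSet_Ioi
  have hanti : AntitoneOn g (Set.Icc 1 (T + 1)) := fun s hs t _ hst =>
    sub_le_sub_left (Nat.cast_le.mpr (mult_one_le_of_subset _ (Set.image_mono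
      (absUpperRam_antitone (sub_nonneg.mpr hs.1) (sub_le_sub_right hst 1))))) _
  have hzero : ∀ t ∈ Set.Ioi (1 : ℝ) \ Set.Icc 1 (T + 1), g t = 0 := by
    intro t ht
    have htT : T ≤ t - 1 := by
      by_contra h
      exact ht.2 ⟨le_of_lt ht.1, by linarith⟩
    have : mult (f '' absUpperRam K (t - 1)) (extendScalars (Sep K) τ) 1 =
        Module.finrank K W := by
      rw [mult_one_eq_finrank, Module.finrank_baseChange]
      rintro _ ⟨σ, hσ, rfl⟩
      exact hT _ htT σ hσ
    simp only [g, this, sub_self]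
  exact (hanti.integrableOn_isCompact isCompact_Icc).of_forall_sdiff_eq_zero measurableSet_Ioi hzero

variable [Finite G] {V : Type*} [AddCommGroup V] [Module ℚ V] [FiniteDimensional ℚ V]
variable {ρ : Representation ℚ G V} {τ : Representation K G W}

variable (f : AbsGal K →ₜ* G)

theorem artinIntegrand_of_lt_one (hG : ((Nat.card G : ℕ) : K) ≠ 0) (hτ : Corresponds ρ τ)
    {t : ℝ} (ht : t < 1) :
    artinIntegrand f (fun g => ((ρ.character g : ℚ) : ℂ)) t = (((Module.finrank K W : ℝ) -
      mult (inertiaImage f : Set G) (extendScalars (Sep K) τ) 1 : ℝ) : ℂ) := by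
  rw [artinIntegrand, image_ramGroup_of_lt_one f ht,
    innerProd_one_eq_mult_of_corresponds (Sep K) hG hτ,
    hτ.character_one]
  push_cast
  rfl

theorem artinIntegrand_of_one_lt (hG : ((Nat.card G : ℕ) : K) ≠ 0) (hτ : Corresponds ρ τ)
    {t : ℝ} (ht : 1 < t) :
    artinIntegrand f (fun g => ((ρ.character g : ℚ) : ℂ)) t = (fineIntegrand f τ t : ℂ) := by
  have h : f '' ramGroup K t =
      ((absUpperGroup (K := K) (sub_nonneg.mpr ht.le)).map (f : AbsGal K →* G) : Subgroup G) := by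
    rw [ramGroup_of_one_lt ht]; rfl
  rw [artinIntegrand, fineIntegrand, ramGroupBar_of_one_le ht.le, h,
    innerProd_one_eq_mult_of_corresponds (Sep K) hG hτ, hτ.character_one]
  push_cast
  rfl

variable [DiscreteTopology G]

/-- The contribution of tame ramification: the invariants of wild inertia decompose under the
powers of `γ_f`. -/
theorem mult_wildImage_eq (hG : ((Nat.card G : ℕ) : K) ≠ 0) (hτ : Corresponds ρ τ) :
    mult (wildImage f : Set G) (extendScalars (Sep K) τ) 1 =
      (∑ d ∈ (e₀ f).properDivisors, Nat.totient (e₀ f / d) *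
        mult (f '' ramGroup K 0) (extendScalars (Sep K) τ) (gammaF f ^ d)) +
      mult (inertiaImage f : Set G) (extendScalars (Sep K) τ) 1 := by
  obtain ⟨n, b, c, M, hM⟩ := hτ
  have hG' : ((Nat.card G : ℕ) : Sep K) ≠ 0 := by
    rw [← map_natCast (algebraMap K (Sep K))]
    exact (map_ne_zero _).mpr hG
  obtain ⟨ζ, k, hζ, hγ, hk, hkP⟩ := exists_gammaF_eq_pow f
  rw [mult_one_eq_add_sum_properDivisors (toMatrix_extendScalars (E := Sep K) τ c fun g => (hM g).2)
    (toMatrix_extendScalars (E := ℂ) ρ b fun g => (hM g).1) hG' (wildImage_le_inertiaImage f)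
    (e₀_pos f) hk hkP (card_inertiaImage f) hζ, image_ramGroup_of_lt_one f one_pos]
  congr 1
  refine Finset.sum_congr rfl fun d _ => congrArg _ (mult_congr _ fun g hg => ?_)
  rw [Pi.pow_apply, hγ g hg]

end Conductors

end FineArtin

open FineArtin in
theorem mainTheorem4
    {K : Type*} [Field K] [ValuativeRel K] [TopologicalSpace K] [IsNonarchimedeanLocalField K]
    {G : Type*} [Group G] [Finite G] [TopologicalSpace G] [DiscreteTopology G]
    (hG : ((Nat.card G : ℕ) : K) ≠ 0)
    (f : FineArtin.AbsGal K →ₜ* G)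
    {V : Type*} [AddCommGroup V] [Module ℚ V] [FiniteDimensional ℚ V]
    (ρ : Representation ℚ G V)
    {W : Type*} [AddCommGroup W] [Module K W] [FiniteDimensional K W]
    (τ : Representation K G W) (hτ : FineArtin.Corresponds ρ τ) :
    IntegrableOn (FineArtin.artinIntegrand f fun g => ((ρ.character g : ℚ) : ℂ)) (Set.Ioi 0) ∧
    IntegrableOn (FineArtin.fineIntegrand f τ) (Set.Ioi 0) ∧
    (FineArtin.fineConductor f τ : ℂ) =
      FineArtin.artinConductor f fun g => ((ρ.character g : ℚ) : ℂ) := by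
  set ψ : G → ℂ := fun g => ((ρ.character g : ℚ) : ℂ)
  let A : ℝ := (Module.finrank K W : ℝ) -
    mult (inertiaImage f : Set G) (extendScalars (Sep K) τ) 1
  let B : ℝ := (Module.finrank K W : ℝ) -
    mult (wildImage f : Set G) (extendScalars (Sep K) τ) 1
  have hfin : volume (Set.Ioo (0 : ℝ) 1) ≠ ⊤ := by simp
  have hcover : Set.Ioi (0 : ℝ) = Set.Ioc 0 1 ∪ Set.Ioi 1 :=
    (Set.Ioc_union_Ioi_eq_Ioi zero_le_one).symm
  have hA : Set.EqOn (fun _ => (A : ℂ)) (artinIntegrand f ψ) (Set.Ioo 0 1) := fun t ht =>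
    (artinIntegrand_of_lt_one f hG hτ ht.2).symm
  have hB : Set.EqOn (fun _ => B) (fineIntegrand f τ) (Set.Ioc 0 1) := fun t ht => by
    rw [fineIntegrand, ramGroupBar_of_le_one ht.2, image_ramGroup_one]
  have hC : Set.EqOn (fun t => (fineIntegrand f τ t : ℂ)) (artinIntegrand f ψ) (Set.Ioi 1) :=
    fun t ht => (artinIntegrand_of_one_lt f hG hτ ht).symm
  have hA1 : IntegrableOn (artinIntegrand f ψ) (Set.Ioc 0 1) :=
    (integrableOn_Ioc_iff_integrableOn_Ioo (by finiteness)).mpr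
      ((integrableOn_const hfin).congr_fun hA measurableSet_Ioo)
  have hB1 : IntegrableOn (fineIntegrand f τ) (Set.Ioc 0 1) :=
    (integrableOn_const (by simp)).congr_fun hB measurableSet_Ioc
  have hB2 := integrableOn_fineIntegrand_Ioi_one f τ
  have hA2 : IntegrableOn (artinIntegrand f ψ) (Set.Ioi 1) :=
    IntegrableOn.congr_fun hB2.ofReal hC measurableSet_Ioi
  refine ⟨hcover ▸ hA1.union hA2, hcover ▸ hB1.union hB2, ?_⟩
  have hdisj : Disjoint (Set.Ioc (0 : ℝ) 1) (Set.Ioi 1) := Set.Ioc_disjoint_Ioi le_rfl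
  rw [artinConductor, fineConductor, hcover, setIntegral_union hdisj measurableSet_Ioi hA1 hA2,
    setIntegral_union hdisj measurableSet_Ioi hB1 hB2,
    integral_Ioc_eq_integral_Ioo (f := artinIntegrand f ψ),
    ← setIntegral_congr_fun measurableSet_Ioo hA, ← setIntegral_congr_fun measurableSet_Ioc hB,
    ← setIntegral_congr_fun measurableSet_Ioi hC, setIntegral_const,
    setIntegral_const, integral_complex_ofReal]
  -- the values of the integrands on `(0, 1)` differ by the contribution of tame ramification
  have key : (mult (wildImage f : Set G) (extendScalars (Sep K) τ) 1 : ℂ) = _ :=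
    congrArg Nat.cast (mult_wildImage_eq f hG hτ)
  simp only [A, B, measureReal_def, Real.volume_Ioo, Real.volume_Ioc]
  push_cast at key ⊢
  simp [key]
  ring
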